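/- **Setting.** For $q>0$ put $[t]_q=(q^t-q^{-t})/(q-q^{-1})$ if $q\neq1$ and $[t]_1=t$. For $S\in\frac12\mathbb Z_{\ge0}$ let $n=2S+1$ and let $\mathcal H^q_S=\mathbb C^n$ be the irreducible spin-$S$ $*$-module of $U_q(su_2)$ (of $U(su_2)$ if $q=1$), with orthonormal basis $|m\rangle$, $m=S,S-1,\dots,-S$, and $$X^{+}|m\rangle=\sqrt{[S-m]_q[S+m+1]_q}\,|m+1\rangle,\quad X^-=(X^+)^*,\quad K|m\rangle=q^m|m\rangle,\quad H|m\rangle=m|m\rangle .$$ The comultiplication is $\Delta(X^\pm)=X^\pm\otimes K+K^{-1}\otimes X^\pm$, $\Delta(K^{\pm1})=K^{\pm1}\otimes K^{\pm1}$ for $q\ne1$, and $\Delta(X^\pm)=X^\pm\otimes1+1\otimes X^\pm$, $\Delta(H)=H\otimes1+1\otimes H$ for $q=1$. The Casimir elements are $C_q=X^-X^++\frac{(K-K^{-1})(qK-q^{-1}K^{-1})}{(q-q^{-1})^2}$ for $q\ne1$ and $C_1=X^-X^++H(H+1)$. For integers $0\le J\le 2S$ and $-J\le m\le J$, let $|J,m\rangle_q\in\mathcal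 H^q_S\otimes\mathcal H^q_S$ be the unit joint eigenvector (unique up to a phase) of $\Delta(K)$ and $\Delta(C_q)$ with eigenvalues $q^m$ and $[J]_q[J+1]_q$ (for $q=1$: of $\Delta(H)$ and $\Delta(C_1)$ with eigenvalues $m$ and $J(J+1)$). A pair of orthogonal vectors $|J_1,m_1\rangle_q$, $|J_2,m_2\rangle_q$ is called a *TL pair*, with value $Q>0$, if $T=QP$, where $P$ is the orthogonal projection of $\mathcal H^q_S\otimes\mathcal H^q_S$ onto their span, satisfies $$T^*=T,\quad T^2=QT,\quad T_{12}T_{23}T_{12}=T_{12},\quad T_{23}T_{12}T_{23}=T_{23},$$ where $T_{12}=T\otimes I_n$ and $T_{23}=I_n\otimes T$. Pairs are considered up to the order of the two vectors, written so that $J_1\ge J_2$. **Theorem.** a) For $q=1$, the exhaustive list of TL pairs $|J_1,m_1\rangle_{1},|J_2,m_2\rangle_{1}$ with $J_1\ge J_2$ is: (i) $|1,m\rangle_1,|1,-m\rangle_1$; (ii) $|1,m\rangle_1,|1,0\rangle_1$; (iii) $|2,m\rangle_1,|1,-m\rangle_1$; (iv) $|2,m\rangle_1,|1,0\rangle_1$;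 (v) $|2,m\rangle_1,|2,-m\rangle_1$; in all cases $S=1$ and $m=\pm1$. For each of them $Q=2$ is the one value of $Q>0$ for which $QP$ satisfies the relations. b) The exhaustive list of pairs $|J_1,m_1\rangle_q,|J_2,m_2\rangle_q$ with $J_1\ge J_2$ that are TL pairs for all $q>0$ is: (i) $|2,1\rangle_q,|1,-1\rangle_q$; (ii) $|2,-1\rangle_q,|1,1\rangle_q$; in both cases $S=1$. For each of them and each $q>0$, $Q=q^2+q^{-2}$ is the one value of $Q>0$ for which $QP$ satisfies the relations. -/

import Mathlib

open scoped Kronecker Matrix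

namespace TLPairs

noncomputable section

/-! ### The Temperley-Lieb relations for a matrix on `ℂⁿ ⊗ ℂⁿ` -/

/-- Operators on `ℂⁿ ⊗ ℂⁿ`, as matrices in the basis `e_a ⊗ e_b`. -/
abbrev Op2 (n : ℕ) : Type := Matrix (Fin n × Fin n) (Fin n × Fin n) ℂ

/-- Operators on `ℂⁿ ⊗ ℂⁿ ⊗ ℂⁿ`, as matrices in the basis `e_a ⊗ e_b ⊗ e_c`. -/
abbrev Op3 (n : ℕ) : Type :=
  Matrix (Fin n × Fin n × Fin n) (Fin n × Fin n × Fin n) ℂ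

/-- `T₁₂ = T ⊗ I`. -/
def act12 {n : ℕ} (T : Op2 n) : Op3 n :=
  Matrix.reindex (Equiv.prodAssoc _ _ _) (Equiv.prodAssoc _ _ _)
    (T ⊗ₖ (1 : Matrix (Fin n) (Fin n) ℂ))

/-- `T₂₃ = I ⊗ T`. -/
def act23 {n : ℕ} (T : Op2 n) : Op3 n :=
  (1 : Matrix (Fin n) (Fin n) ℂ) ⊗ₖ T

/-- The four relations that define a unitary tensor space representation of the
Temperley-Lieb algebra with loop parameter `Q`. -/
structure IsTLSolution {n : ℕ} (Q : ℝ) (T : Op2 n) : Prop where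
  hermitian : Tᴴ = T
  quadratic : T * T = (Q : ℂ) • T
  braid12 : act12 T * act23 T * act12 T = act12 T
  braid23 : act23 T * act12 T * act23 T = act23 T

/-! ### The spin `S` module of `U_q(su₂)` and its tensor square

Throughout `d = 2 S`, so that `n = 2 S + 1 = d + 1`, and the basis vector `e_a`,
`a = 0, …, d`, is the weight vector `|S - a⟩`. -/

/-- The `q`-number `[t]_q = (q^t - q^(-t)) / (q - q⁻¹)`, with `[t]_1 = t`. -/
def qNum (q t : ℝ) : ℝ :=
  if q = 1 then t else (q ^ t - q ^ (-t)) / (q - q⁻¹)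

/-- The weight `S - a` of the basis vector `e_a`. -/
def weight (d : ℕ) (a : Fin (d + 1)) : ℝ := (d : ℝ) / 2 - (a : ℝ)

/-- Operators on the spin `d / 2` module. -/
abbrev Op1 (d : ℕ) : Type := Matrix (Fin (d + 1)) (Fin (d + 1)) ℂ

/-- The raising operator, `X⁺ |m⟩ = √([S - m]_q [S + m + 1]_q) |m + 1⟩`. -/
def raise (d : ℕ) (q : ℝ) : Op1 d :=
  Matrix.of fun a b =>
    if (a : ℕ) + 1 = (b : ℕ) then
      ((Real.sqrt (qNum q ((d : ℝ) / 2 - weight d b) *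
        qNum q ((d : ℝ) / 2 + weight d b + 1)) : ℝ) : ℂ)
    else 0

/-- The lowering operator `X⁻ = (X⁺)*`. -/
def lower (d : ℕ) (q : ℝ) : Op1 d := (raise d q)ᴴ

/-- `K |m⟩ = q^m |m⟩` (the identity for `q = 1`). -/
def opK (d : ℕ) (q : ℝ) : Op1 d :=
  Matrix.diagonal fun a => ((q ^ weight d a : ℝ) : ℂ)

/-- `K⁻¹ |m⟩ = q^(-m) |m⟩` (the identity for `q = 1`). -/
def opKinv (d : ℕ) (q : ℝ) : Op1 d :=
  Matrix.diagonal fun a => ((q ^ (-weight d a) : ℝ) : ℂ)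

/-- `H |m⟩ = m |m⟩`. -/
def opH (d : ℕ) : Op1 d := Matrix.diagonal fun a => ((weight d a : ℝ) : ℂ)

/-- The comultiplication of `X = X⁺` or `X = X⁻`: `X ⊗ K + K⁻¹ ⊗ X`, which for `q = 1`
is `X ⊗ 1 + 1 ⊗ X`. -/
def deltaX (d : ℕ) (q : ℝ) (X : Op1 d) : Op2 (d + 1) :=
  X ⊗ₖ opK d q + opKinv d q ⊗ₖ X

/-- `Δ(K) = K ⊗ K`. -/
def deltaK (d : ℕ) (q : ℝ) : Op2 (d + 1) := opK d q ⊗ₖ opK d q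

/-- `Δ(K⁻¹) = K⁻¹ ⊗ K⁻¹`. -/
def deltaKinv (d : ℕ) (q : ℝ) : Op2 (d + 1) := opKinv d q ⊗ₖ opKinv d q

/-- `Δ(H) = H ⊗ 1 + 1 ⊗ H`. -/
def deltaH (d : ℕ) : Op2 (d + 1) :=
  opH d ⊗ₖ (1 : Op1 d) + (1 : Op1 d) ⊗ₖ opH d

/-- `Δ(C₁)`, where `C₁ = X⁻ X⁺ + H (H + 1)` is the Casimir element of `U(su₂)`. -/
def deltaCasimirOne (d : ℕ) : Op2 (d + 1) :=
  deltaX d 1 (lower d 1) * deltaX d 1 (raise d 1) + deltaH d * (deltaH d + 1)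

/-- `Δ(C_q)`, where `C_q = X⁻ X⁺ + (K - K⁻¹)(q K - q⁻¹ K⁻¹) / (q - q⁻¹)²` is the Casimir
element of `U_q(su₂)`, `q ≠ 1`. -/
def deltaCasimir (d : ℕ) (q : ℝ) : Op2 (d + 1) :=
  deltaX d q (lower d q) * deltaX d q (raise d q) +
    (((q - q⁻¹) ^ 2 : ℝ) : ℂ)⁻¹ •
      ((deltaK d q - deltaKinv d q) *
        ((q : ℂ) • deltaK d q - ((q⁻¹ : ℝ) : ℂ) • deltaKinv d q))

/-- `v` is a vector `|J,m⟩_q` of the tensor square of the spin `d / 2` module: a unit joint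
eigenvector of `Δ(K)` and `Δ(C_q)` with eigenvalues `q^m` and `[J]_q [J+1]_q` (of `Δ(H)` and
`Δ(C₁)` with eigenvalues `m` and `J (J + 1)`, if `q = 1`), where `0 ≤ J ≤ d` and
`-J ≤ m ≤ J`. It is determined up to a phase. -/
def IsKet (d : ℕ) (q : ℝ) (J : ℕ) (m : ℤ) (v : Fin (d + 1) × Fin (d + 1) → ℂ) : Prop :=
  J ≤ d ∧ |m| ≤ (J : ℤ) ∧ star v ⬝ᵥ v = 1 ∧
  (q = 1 →
    deltaH d *ᵥ v = (m : ℂ) • v ∧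
    deltaCasimirOne d *ᵥ v = ((J : ℂ) * ((J : ℂ) + 1)) • v) ∧
  (q ≠ 1 →
    deltaK d q *ᵥ v = ((q ^ m : ℝ) : ℂ) • v ∧
    deltaCasimir d q *ᵥ v = ((qNum q (J : ℝ) * qNum q ((J : ℝ) + 1) : ℝ) : ℂ) • v)

/-! ### TL pairs -/

/-- `P` is the orthogonal projection onto the span of `v₁` and `v₂`. -/
def IsProjOnSpan {n : ℕ} (P : Op2 n) (v₁ v₂ : Fin n × Fin n → ℂ) : Prop :=
  Pᴴ = P ∧ P * P = P ∧ LinearMap.range P.mulVecLin = Submodule.span ℂ {v₁, v₂}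

/-- `|J₁,m₁⟩_q` and `|J₂,m₂⟩_q` (for spin `d / 2`) are orthogonal and `T = Q P` satisfies the
Temperley-Lieb relations, where `P` is the orthogonal projection onto their span. -/
def IsTLPairWith (d : ℕ) (q Q : ℝ) (J₁ : ℕ) (m₁ : ℤ) (J₂ : ℕ) (m₂ : ℤ) : Prop :=
  ∃ v₁ v₂ : Fin (d + 1) × Fin (d + 1) → ℂ, ∃ P : Op2 (d + 1),
    IsKet d q J₁ m₁ v₁ ∧ IsKet d q J₂ m₂ v₂ ∧ star v₁ ⬝ᵥ v₂ = 0 ∧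
    IsProjOnSpan P v₁ v₂ ∧ IsTLSolution Q ((Q : ℂ) • P)

/-- `|J₁,m₁⟩_q` and `|J₂,m₂⟩_q` (for spin `d / 2`) form a TL pair. -/
def IsTLPair (d : ℕ) (q : ℝ) (J₁ : ℕ) (m₁ : ℤ) (J₂ : ℕ) (m₂ : ℤ) : Prop :=
  ∃ Q : ℝ, 0 < Q ∧ IsTLPairWith d q Q J₁ m₁ J₂ m₂

end

end TLPairs

/-!
Let `V` be the isometry with columns `v₁` and `v₂`, so that `Q P = Q V V*`. Both cubic relations say
that `Q` times the square matrix `(I ⊗ V)* (V ⊗ I)` is unitary. Since `v₁` and `v₂` are weight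
vectors, its Gram matrix has diagonal entries that are sums of two products of squared moduli of
coefficients. The coefficients themselves solve a three-term recurrence given by the Casimir
element, whose solution space is at most one-dimensional.

At `q = 1` the recurrence is invariant under the exchange of the tensor factors, so the squared
moduli are symmetric, and where only one product survives the diagonal relations give the squared
modulus `Q⁻¹`. Runs of equal squared moduli at the uppermost indices determine the weight through
the edge of the recurrence; this leaves only spin one and `|m₁ - m₂| ≤ 2`.

For spin one and any `q`, the two squared moduli of `|J,±1⟩_q` are `q² / (q² + q⁻²)` and
`q⁻² / (q² + q⁻²)`, in an order that depends on `J`. Two vectors of opposite weights `±1` form a TL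
pair if and only if these orders are opposite (`J₁ ≠ J₂`) or do not matter (`q = 1`), and a vector
of weight `0` forces `q = 1`.
-/

namespace TLPairs

section Criterion

variable {n : ℕ} {ι : Type*}

/-- The operator `V ⊗ I` from `ℂ^ι ⊗ ℂⁿ` to `ℂⁿ ⊗ ℂⁿ ⊗ ℂⁿ`, where the columns of `V` are vectors
of `ℂⁿ ⊗ ℂⁿ`. -/
def leftLeg (V : Matrix (Fin n × Fin n) ι ℂ) :
    Matrix (Fin n × Fin n × Fin n) (ι × Fin n) ℂ :=
  Matrix.reindex (Equiv.prodAssoc _ _ _) (Equiv.refl _) (V ⊗ₖ (1 : Matrix (Fin n) (Fin n) ℂ))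

/-- The operator `I ⊗ V` from `ℂⁿ ⊗ ℂ^ι` to `ℂⁿ ⊗ ℂⁿ ⊗ ℂⁿ`. -/
def rightLeg (V : Matrix (Fin n × Fin n) ι ℂ) :
    Matrix (Fin n × Fin n × Fin n) (Fin n × ι) ℂ :=
  (1 : Matrix (Fin n) (Fin n) ℂ) ⊗ₖ V

/-- The matrix of the inner products of the vectors `e_a ⊗ v_j` with the vectors `v_k ⊗ e_c`, where
`v_j` are the columns of `V`. -/
def overlap (V : Matrix (Fin n × Fin n) ι ℂ) : Matrix (Fin n × ι) (ι × Fin n) ℂ :=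
  (rightLeg V)ᴴ * leftLeg V

lemma overlap_apply (V : Matrix (Fin n × Fin n) ι ℂ) (a c : Fin n) (j k : ι) :
    overlap V (a, j) (k, c) = ∑ b, star (V (b, c) j) * V (a, b) k := by
  simp only [overlap, rightLeg, leftLeg, Matrix.mul_apply, Matrix.conjTranspose_apply,
    Matrix.reindex_apply, Matrix.submatrix_apply, Equiv.prodAssoc_symm_apply, Equiv.refl_symm,
    Equiv.coe_refl, id_eq, Matrix.kroneckerMap_apply, Matrix.one_apply, Fintype.sum_prod_type]
  simp [apply_ite star, ite_mul, Finset.sum_ite_irrel]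

lemma act12_mul_conjTranspose [Fintype ι] (V : Matrix (Fin n × Fin n) ι ℂ) :
    act12 (V * Vᴴ) = leftLeg V * (leftLeg V)ᴴ := by
  classical
  have hkron : (V * Vᴴ) ⊗ₖ (1 : Matrix (Fin n) (Fin n) ℂ) =
      V ⊗ₖ (1 : Matrix (Fin n) (Fin n) ℂ) * (V ⊗ₖ (1 : Matrix (Fin n) (Fin n) ℂ))ᴴ := by
    rw [Matrix.conjTranspose_kronecker, ← Matrix.mul_kronecker_mul, Matrix.conjTranspose_one,
      Matrix.mul_one]
  rw [act12, hkron]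
  exact Matrix.submatrix_mul _ _ _ _ _ Function.bijective_id

lemma act23_mul_conjTranspose [Fintype ι] (V : Matrix (Fin n × Fin n) ι ℂ) :
    act23 (V * Vᴴ) = rightLeg V * (rightLeg V)ᴴ := by
  simp [act23, rightLeg, Matrix.conjTranspose_kronecker, ← Matrix.mul_kronecker_mul]

lemma act12_smul (c : ℂ) (T : Op2 n) : act12 (c • T) = c • act12 T := by
  rw [act12, Matrix.smul_kronecker]
  rfl

lemma act23_smul (c : ℂ) (T : Op2 n) : act23 (c • T) = c • act23 T :=
  Matrix.kronecker_smul c 1 T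

lemma leftLeg_isometry [DecidableEq ι] {V : Matrix (Fin n × Fin n) ι ℂ} (hV : Vᴴ * V = 1) :
    (leftLeg V)ᴴ * leftLeg V = 1 := by
  simp [leftLeg, Matrix.conjTranspose_submatrix, Matrix.conjTranspose_kronecker,
    ← Matrix.mul_kronecker_mul, hV]

lemma rightLeg_isometry [DecidableEq ι] {V : Matrix (Fin n × Fin n) ι ℂ} (hV : Vᴴ * V = 1) :
    (rightLeg V)ᴴ * rightLeg V = 1 := by
  simp [rightLeg, Matrix.conjTranspose_kronecker, ← Matrix.mul_kronecker_mul, hV]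

lemma isometry_conj_inj {κ μ : Type*} [Fintype κ] [DecidableEq κ] [Fintype μ]
    {L : Matrix μ κ ℂ} (hL : Lᴴ * L = 1) {X Y : Matrix κ κ ℂ} :
    L * X * Lᴴ = L * Y * Lᴴ ↔ X = Y := by
  refine ⟨fun h => ?_, fun h => by rw [h]⟩
  have key : ∀ Z : Matrix κ κ ℂ, Lᴴ * (L * Z * Lᴴ) * L = Z := fun Z =>
    calc Lᴴ * (L * Z * Lᴴ) * L = Lᴴ * L * Z * (Lᴴ * L) := by simp only [Matrix.mul_assoc]
      _ = Z := by rw [hL, Matrix.one_mul, Matrix.mul_one]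
  rw [← key X, h, key]

lemma isometry_braid_iff {κ μ ν : Type*} [Fintype κ] [DecidableEq κ] [Fintype μ] [Fintype ν]
    {L : Matrix μ κ ℂ} {R : Matrix μ ν ℂ} (hL : Lᴴ * L = 1) {c : ℂ} (hc : c ≠ 0) :
    (c • (L * Lᴴ)) * (c • (R * Rᴴ)) * (c • (L * Lᴴ)) = c • (L * Lᴴ) ↔
      c ^ 2 • ((Rᴴ * L)ᴴ * (Rᴴ * L)) = 1 := by
  have expand : (c • (L * Lᴴ)) * (c • (R * Rᴴ)) * (c • (L * Lᴴ)) =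
      c • (L * (c ^ 2 • ((Rᴴ * L)ᴴ * (Rᴴ * L))) * Lᴴ) := by
    simp only [Matrix.smul_mul, Matrix.mul_smul, smul_smul, Matrix.mul_assoc,
      Matrix.conjTranspose_mul, Matrix.conjTranspose_conjTranspose, pow_two]
  have expand_one : c • (L * Lᴴ) = c • (L * (1 : Matrix κ κ ℂ) * Lᴴ) := by rw [Matrix.mul_one]
  rw [expand, expand_one, (smul_right_injective _ hc).eq_iff, isometry_conj_inj hL]

-- The overlap matrix is square, so both braid relations say that `Q • overlap V` is unitary.
lemma isTLSolution_smul_iff [Fintype ι] [DecidableEq ι] {V : Matrix (Fin n × Fin n) ι ℂ}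
    (hV : Vᴴ * V = 1) {Q : ℝ} (hQ : Q ≠ 0) :
    IsTLSolution Q ((Q : ℂ) • (V * Vᴴ)) ↔
      (Q : ℂ) ^ 2 • ((overlap V)ᴴ * overlap V) = 1 := by
  have hQ' : (Q : ℂ) ≠ 0 := Complex.ofReal_ne_zero.2 hQ
  have braid12 := isometry_braid_iff (R := rightLeg V) (leftLeg_isometry hV) hQ'
  have braid23 := isometry_braid_iff (R := leftLeg V) (rightLeg_isometry hV) hQ'
  rw [← act12_mul_conjTranspose, ← act23_mul_conjTranspose, ← act12_smul, ← act23_smul]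
    at braid12 braid23
  refine ⟨fun h => braid12.1 h.braid12, fun h => ⟨?_, ?_, braid12.2 h, braid23.2 ?_⟩⟩
  · simp
  · have idem : V * Vᴴ * (V * Vᴴ) = V * Vᴴ := by
      rw [Matrix.mul_assoc, ← Matrix.mul_assoc Vᴴ, hV, Matrix.one_mul]
    rw [Matrix.smul_mul, Matrix.mul_smul, idem]
  · rw [← Matrix.smul_mul, Matrix.mul_eq_one_comm_of_equiv (Equiv.prodComm _ _)] at h
    simpa [overlap] using h

end Criterion

section Projection

lemma mul_eq_of_range_le {α : Type*} [Fintype α] {P R : Matrix α α ℂ}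
    (hR : R * R = R) (h : LinearMap.range P.mulVecLin ≤ LinearMap.range R.mulVecLin) :
    R * P = P := by
  classical
  refine Matrix.ext_of_mulVec_single fun x => ?_
  obtain ⟨y, hy⟩ := h ⟨Pi.single x 1, rfl⟩
  rw [Matrix.mulVecLin_apply, Matrix.mulVecLin_apply] at hy
  rw [← Matrix.mulVec_mulVec, ← hy, Matrix.mulVec_mulVec, hR]

lemma hermitian_idempotent_ext {α : Type*} [Fintype α] {P R : Matrix α α ℂ}
    (hP : Pᴴ = P) (hPP : P * P = P) (hR : Rᴴ = R) (hRR : R * R = R)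
    (h : LinearMap.range P.mulVecLin = LinearMap.range R.mulVecLin) : P = R :=
  calc P = (R * P)ᴴ := by rw [mul_eq_of_range_le hRR h.le, hP]
    _ = P * R := by rw [Matrix.conjTranspose_mul, hP, hR]
    _ = R := mul_eq_of_range_le hPP h.ge

variable {n : ℕ}

/-- The matrix with columns `v₁` and `v₂`. -/
abbrev pairMatrix {α : Type*} (v₁ v₂ : α → ℂ) : Matrix α (Fin 2) ℂ := (Matrix.of ![v₁, v₂])ᵀ

lemma pairMatrix_isometry {α : Type*} [Fintype α] {v₁ v₂ : α → ℂ} (h₁ : star v₁ ⬝ᵥ v₁ = 1)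
    (h₂ : star v₂ ⬝ᵥ v₂ = 1) (h₁₂ : star v₁ ⬝ᵥ v₂ = 0) :
    (pairMatrix v₁ v₂)ᴴ * pairMatrix v₁ v₂ = 1 := by
  have h₂₁ : star v₂ ⬝ᵥ v₁ = 0 := by rw [Matrix.star_dotProduct, h₁₂, star_zero]
  ext i j
  fin_cases i <;> fin_cases j
  · exact h₁
  · exact h₁₂
  · exact h₂₁
  · exact h₂

lemma range_mul_conjTranspose {α ι : Type*} [Fintype α] [Fintype ι] [DecidableEq ι]
    {V : Matrix α ι ℂ} (hV : Vᴴ * V = 1) :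
    LinearMap.range (V * Vᴴ).mulVecLin = Submodule.span ℂ (Set.range V.col) := by
  rw [← Matrix.range_mulVecLin, Matrix.mulVecLin_mul]
  refine le_antisymm (LinearMap.range_comp_le_range _ _) ?_
  rintro _ ⟨x, rfl⟩
  exact ⟨V *ᵥ x, by simp [Matrix.mulVec_mulVec, hV]⟩

lemma isProjOnSpan_iff {v₁ v₂ : Fin n × Fin n → ℂ}
    (hV : (pairMatrix v₁ v₂)ᴴ * pairMatrix v₁ v₂ = 1) (P : Op2 n) :
    IsProjOnSpan P v₁ v₂ ↔ P = pairMatrix v₁ v₂ * (pairMatrix v₁ v₂)ᴴ := by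
  have hherm : (pairMatrix v₁ v₂ * (pairMatrix v₁ v₂)ᴴ)ᴴ =
      pairMatrix v₁ v₂ * (pairMatrix v₁ v₂)ᴴ := by simp
  have hidem : pairMatrix v₁ v₂ * (pairMatrix v₁ v₂)ᴴ *
      (pairMatrix v₁ v₂ * (pairMatrix v₁ v₂)ᴴ) = pairMatrix v₁ v₂ * (pairMatrix v₁ v₂)ᴴ := by
    rw [Matrix.mul_assoc, ← Matrix.mul_assoc (_ᴴ), hV, Matrix.one_mul]
  have hrange := range_mul_conjTranspose hV
  have hcols : Set.range (pairMatrix v₁ v₂).col = {v₁, v₂} := Matrix.range_cons_cons_empty ..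
  rw [hcols] at hrange
  constructor
  · rintro ⟨hP, hPP, hspan⟩
    exact hermitian_idempotent_ext hP hPP hherm hidem (hspan.trans hrange.symm)
  · rintro rfl
    exact ⟨hherm, hidem, hrange⟩

end Projection

section Pairs

variable {d : ℕ} {q Q : ℝ} {J₁ J₂ : ℕ} {m₁ m₂ : ℤ}

lemma isTLPairWith_iff (hQ : Q ≠ 0) :
    IsTLPairWith d q Q J₁ m₁ J₂ m₂ ↔
      ∃ v₁ v₂ : Fin (d + 1) × Fin (d + 1) → ℂ,
        IsKet d q J₁ m₁ v₁ ∧ IsKet d q J₂ m₂ v₂ ∧ star v₁ ⬝ᵥ v₂ = 0 ∧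
        (Q : ℂ) ^ 2 • ((overlap (pairMatrix v₁ v₂))ᴴ * overlap (pairMatrix v₁ v₂)) = 1 := by
  refine exists₂_congr fun v₁ v₂ => ?_
  constructor
  · rintro ⟨P, h₁, h₂, h₁₂, hP, hTL⟩
    have hV := pairMatrix_isometry h₁.2.2.1 h₂.2.2.1 h₁₂
    rw [(isProjOnSpan_iff hV P).1 hP] at hTL
    exact ⟨h₁, h₂, h₁₂, (isTLSolution_smul_iff hV hQ).1 hTL⟩
  · rintro ⟨h₁, h₂, h₁₂, hN⟩
    have hV := pairMatrix_isometry h₁.2.2.1 h₂.2.2.1 h₁₂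
    exact ⟨_, h₁, h₂, h₁₂, (isProjOnSpan_iff hV _).2 rfl, (isTLSolution_smul_iff hV hQ).2 hN⟩

lemma IsTLPairWith.symm (h : IsTLPairWith d q Q J₁ m₁ J₂ m₂) :
    IsTLPairWith d q Q J₂ m₂ J₁ m₁ := by
  obtain ⟨v₁, v₂, P, h₁, h₂, h₁₂, ⟨hP, hPP, hspan⟩, hTL⟩ := h
  refine ⟨v₂, v₁, P, h₂, h₁, ?_, ⟨hP, hPP, by rw [hspan, Set.pair_comm]⟩, hTL⟩
  rw [Matrix.star_dotProduct, h₁₂, star_zero]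

end Pairs

section Coefficients

variable {n : ℕ}

/-- The coefficients of a vector of `ℂⁿ ⊗ ℂⁿ`, extended by zero to all integer indices, so that
neighbouring coefficients can be compared without boundary cases. -/
def zext (w : Fin n × Fin n → ℂ) (a b : ℤ) : ℂ :=
  if h : (0 ≤ a ∧ a < n) ∧ (0 ≤ b ∧ b < n) then
    w (⟨a.toNat, by omega⟩, ⟨b.toNat, by omega⟩) else 0

lemma zext_coe (w : Fin n × Fin n → ℂ) (a b : Fin n) : zext w (a : ℕ) (b : ℕ) = w (a, b) := by
  simp [zext, a.isLt, b.isLt]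

lemma zext_eq_zero (w : Fin n × Fin n → ℂ) {a b : ℤ}
    (h : ¬ ((0 ≤ a ∧ a < n) ∧ (0 ≤ b ∧ b < n))) : zext w a b = 0 :=
  dif_neg h

lemma zext_eq_of {w : Fin n × Fin n → ℂ} {z : ℂ} {a b : ℤ}
    (h : ∀ a' b' : Fin n, (a' : ℕ) = a → (b' : ℕ) = b → w (a', b') = z)
    (h₀ : ¬ ((0 ≤ a ∧ a < n) ∧ (0 ≤ b ∧ b < n)) → z = 0) : zext w a b = z := by
  by_cases hab : (0 ≤ a ∧ a < n) ∧ (0 ≤ b ∧ b < n)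
  · rw [zext, dif_pos hab]
    exact h _ _ (Int.toNat_of_nonneg hab.1.1) (Int.toNat_of_nonneg hab.2.1)
  · rw [zext_eq_zero w hab, h₀ hab]

lemma zext_injective : Function.Injective (zext (n := n)) := fun w w' h => by
  ext ⟨a, b⟩
  rw [← zext_coe w, ← zext_coe w', h]

lemma zext_smul (z : ℂ) (w : Fin n × Fin n → ℂ) (a b : ℤ) :
    zext (z • w) a b = z * zext w a b := by
  unfold zext
  split_ifs <;> simp

lemma sum_fin_eq {M : Type*} [AddCommMonoid M] (F : ℤ → M) (t : ℤ)
    (h : ∀ x, x ≠ t → F x = 0) (ht : ¬ (0 ≤ t ∧ t < n) → F t = 0) :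
    ∑ a : Fin n, F (a : ℕ) = F t := by
  by_cases h₀ : 0 ≤ t ∧ t < n
  · obtain ⟨hpos, hlt⟩ := h₀
    lift t to ℕ using hpos
    rw [Int.ofNat_lt] at hlt
    refine Finset.sum_eq_single_of_mem (⟨t, hlt⟩ : Fin n) (Finset.mem_univ _) fun x _ hx => h _ ?_
    rwa [Ne, Nat.cast_inj, ← Fin.ext_iff (b := ⟨t, hlt⟩)]
  · rw [ht h₀]
    exact Finset.sum_eq_zero fun x _ => h _ (by omega)

/-- The vector `w` is supported on the antidiagonal `a + b = s`. -/
def SuppOn (w : Fin n × Fin n → ℂ) (s : ℤ) : Prop :=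
  ∀ a b : Fin n, w (a, b) ≠ 0 → (a : ℤ) + (b : ℤ) = s

lemma SuppOn.zext_eq_zero {w : Fin n × Fin n → ℂ} {s a b : ℤ} (h : SuppOn w s)
    (hab : a + b ≠ s) : zext w a b = 0 := by
  unfold zext
  split_ifs
  · by_contra h₀
    have := h _ _ h₀
    simp only at this
    omega
  · rfl

/-- The coefficient of `e_{s-c} ⊗ e_c`. -/
def coeff (w : Fin n × Fin n → ℂ) (s c : ℤ) : ℂ := zext w (s - c) c

/-- The squared modulus of the coefficient of `e_{s-c} ⊗ e_c`. -/
def prob (w : Fin n × Fin n → ℂ) (s c : ℤ) : ℝ := Complex.normSq (coeff w s c)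

lemma coeff_eq_zero (w : Fin n × Fin n → ℂ) {s c : ℤ}
    (h : ¬ ((0 ≤ s - c ∧ s - c < n) ∧ (0 ≤ c ∧ c < n))) : coeff w s c = 0 :=
  zext_eq_zero w h

lemma prob_eq_zero (w : Fin n × Fin n → ℂ) {s c : ℤ}
    (h : ¬ ((0 ≤ s - c ∧ s - c < n) ∧ (0 ≤ c ∧ c < n))) : prob w s c = 0 := by
  rw [prob, coeff_eq_zero w h, map_zero]

lemma sum_mul_of_suppOn {w : Fin n × Fin n → ℂ} {s : ℤ} (h : SuppOn w s) (b : Fin n)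
    (F : ℂ → ℤ → ℂ) (hF : ∀ t, F 0 t = 0) :
    ∑ a : Fin n, F (w (a, b)) (a : ℕ) = F (coeff w s (b : ℕ)) (s - (b : ℕ)) := by
  simp only [← zext_coe w]
  refine sum_fin_eq (fun t => F (zext w t (b : ℕ)) t) _ (fun t ht => ?_) (fun ht => ?_)
  · simp only [h.zext_eq_zero (show t + (b : ℕ) ≠ s by omega), hF]
  · simp only [zext_eq_zero w (fun hab => ht hab.1), hF]

lemma SuppOn.star_dotProduct_self {w : Fin n × Fin n → ℂ} {s : ℤ} (hs : SuppOn w s) :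
    star w ⬝ᵥ w = ((∑ c : Fin n, prob w s (c : ℕ) : ℝ) : ℂ) := by
  rw [dotProduct, Fintype.sum_prod_type_right, Complex.ofReal_sum]
  refine Finset.sum_congr rfl fun c _ => ?_
  exact (sum_mul_of_suppOn hs c (fun z _ => star z * z) (by simp)).trans
    (Complex.normSq_eq_conj_mul_self).symm

section Gram

variable {ι : Type*} {V : Matrix (Fin n × Fin n) ι ℂ} {s : ι → ℤ}

lemma overlap_apply_of_suppOn (hs : ∀ i, SuppOn (V.col i) (s i)) (a c : Fin n) (j k : ι) :
    overlap V (a, j) (k, c) =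
      star (coeff (V.col j) (s j) (c : ℕ)) * zext (V.col k) (a : ℕ) (s j - (c : ℕ)) := by
  have hb : ∀ b : Fin n, V (a, b) k = zext (V.col k) (a : ℕ) (b : ℕ) := fun b =>
    (zext_coe (V.col k) a b).symm
  simp only [overlap_apply, hb]
  exact sum_mul_of_suppOn (hs j) c (fun z t => star z * zext (V.col k) (a : ℕ) t) (by simp)

lemma overlap_gram_apply [Fintype ι] (hs : ∀ i, SuppOn (V.col i) (s i)) {i k : ι}
    {c c' : Fin n} (h : s i + (c : ℕ) = s k + (c' : ℕ)) :
    ((overlap V)ᴴ * overlap V) (i, c) (k, c') =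
      ∑ j, star (coeff (V.col j) (s j) (c' : ℕ)) * coeff (V.col j) (s j) (c : ℕ) *
        (star (coeff (V.col i) (s i) (s j - (c : ℕ))) *
          coeff (V.col k) (s k) (s j - (c' : ℕ))) := by
  simp only [Matrix.mul_apply, Matrix.conjTranspose_apply, Fintype.sum_prod_type_right,
    overlap_apply_of_suppOn hs]
  refine Finset.sum_congr rfl fun j _ => ?_
  have hsum := sum_fin_eq (n := n) (fun x => star (star (coeff (V.col j) (s j) (c : ℕ)) *
      zext (V.col i) x (s j - (c : ℕ))) * (star (coeff (V.col j) (s j) (c' : ℕ)) *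
      zext (V.col k) x (s j - (c' : ℕ)))) (s k - (s j - (c' : ℕ)))
    (fun x hx => by rw [(hs k).zext_eq_zero (by omega)]; simp)
    (fun h => by rw [zext_eq_zero (V.col k) (by tauto)]; simp)
  rw [hsum]
  simp only [coeff, show s i - (s j - (c : ℕ)) = s k - (s j - (c' : ℕ)) by omega, star_mul',
    star_star]
  ring

lemma overlap_gram_eq_zero [Fintype ι] (hs : ∀ i, SuppOn (V.col i) (s i)) {i k : ι}
    {c c' : Fin n} (h : s i + (c : ℕ) ≠ s k + (c' : ℕ)) :
    ((overlap V)ᴴ * overlap V) (i, c) (k, c') = 0 := by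
  rw [Matrix.mul_apply]
  refine Finset.sum_eq_zero fun ⟨a, j⟩ _ => ?_
  rw [Matrix.conjTranspose_apply, overlap_apply_of_suppOn hs, overlap_apply_of_suppOn hs]
  by_cases ha : (a : ℤ) + (s j - (c : ℕ)) = s i
  · rw [(hs k).zext_eq_zero (by omega), mul_zero, mul_zero]
  · rw [(hs i).zext_eq_zero ha, mul_zero, star_zero, zero_mul]

lemma overlap_gram_diag [Fintype ι] (hs : ∀ i, SuppOn (V.col i) (s i)) (i : ι) (c : Fin n) :
    ((overlap V)ᴴ * overlap V) (i, c) (i, c) =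
      ((∑ j, prob (V.col j) (s j) (c : ℕ) *
        prob (V.col i) (s i) (s j - (c : ℕ)) : ℝ) : ℂ) := by
  rw [overlap_gram_apply hs rfl]
  push_cast
  simp only [prob, Complex.normSq_eq_conj_mul_self, starRingEnd_apply]

lemma prob_relation [Fintype ι] [DecidableEq ι] (hs : ∀ i, SuppOn (V.col i) (s i)) {Q : ℝ}
    (h : (Q : ℂ) ^ 2 • ((overlap V)ᴴ * overlap V) = 1) (i : ι) {c : ℤ} (hc : 0 ≤ c)
    (hcn : c < n) :
    ∑ j, prob (V.col j) (s j) c * prob (V.col i) (s i) (s j - c) = (Q⁻¹) ^ 2 := by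
  lift c to ℕ using hc
  rw [Int.ofNat_lt] at hcn
  have hentry := congrFun (congrFun h (i, ⟨c, hcn⟩)) (i, ⟨c, hcn⟩)
  rw [Matrix.smul_apply, overlap_gram_diag hs, Matrix.one_apply_eq, smul_eq_mul] at hentry
  rw [inv_pow]
  exact eq_inv_of_mul_eq_one_right (by exact_mod_cast hentry)

lemma gram_eq_one_of_prob [Fintype ι] [DecidableEq ι] (hs : ∀ i, SuppOn (V.col i) (s i)) {Q : ℝ}
    (hQ : Q ≠ 0)
    (hdiag : ∀ i, ∀ c : ℤ, 0 ≤ c → c < n →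
      ∑ j, prob (V.col j) (s j) c * prob (V.col i) (s i) (s j - c) = Q⁻¹ ^ 2)
    (hoff : ∀ i k, i ≠ k → ∀ j, ∀ c c' : ℤ, s i + c = s k + c' →
      prob (V.col j) (s j) c = 0 ∨ prob (V.col j) (s j) c' = 0 ∨
        prob (V.col i) (s i) (s j - c) = 0 ∨ prob (V.col k) (s k) (s j - c') = 0) :
    (Q : ℂ) ^ 2 • ((overlap V)ᴴ * overlap V) = 1 := by
  ext ⟨i, c⟩ ⟨k, c'⟩
  rw [Matrix.smul_apply, smul_eq_mul]
  by_cases hc : s i + (c : ℕ) = s k + (c' : ℕ)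
  · rcases eq_or_ne i k with rfl | hik
    · obtain rfl : c = c' := by omega
      rw [Matrix.one_apply_eq, overlap_gram_diag hs, hdiag i (c : ℕ) (by omega) (by omega)]
      rw [inv_pow]
      exact_mod_cast mul_inv_cancel₀ (pow_ne_zero 2 hQ)
    · rw [Matrix.one_apply_ne (by simp [hik]), overlap_gram_apply hs hc, Finset.sum_eq_zero,
        mul_zero]
      intro j _
      have hzero := hoff i k hik j _ _ hc
      simp only [prob, Complex.normSq_eq_zero] at hzero
      rcases hzero with h₀ | h₀ | h₀ | h₀ <;> simp [h₀]
  · rw [overlap_gram_eq_zero hs hc, mul_zero, Matrix.one_apply_ne]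
    rintro ⟨⟩
    exact hc rfl

lemma subsingleton_of_suppOn_const [Fintype ι] [DecidableEq ι] {t : ℤ}
    (hs : ∀ i, SuppOn (V.col i) t) (hn : 0 < n) {Q : ℝ} (hQ : Q ≠ 0)
    (h : (Q : ℂ) ^ 2 • ((overlap V)ᴴ * overlap V) = 1) : Subsingleton ι := by
  refine ⟨fun i k => by_contra fun hik => ?_⟩
  set σ : ℝ := ∑ j, prob (V.col j) t 0 with hσ
  have hdiag : ∀ l, σ * prob (V.col l) t t = (Q⁻¹) ^ 2 := fun l => by
    rw [hσ, Finset.sum_mul, ← prob_relation hs h l le_rfl (by exact_mod_cast hn), sub_zero]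
  have hσ₀ : σ ≠ 0 := fun h₀ => pow_ne_zero 2 (inv_ne_zero hQ) (by rw [← hdiag i, h₀, zero_mul])
  have hcoeff : ∀ l, coeff (V.col l) t t ≠ 0 := fun l h₀ =>
    pow_ne_zero 2 (inv_ne_zero hQ) (by rw [← hdiag l, prob, h₀, map_zero, mul_zero])
  have hprob : ∀ l, star (coeff (V.col l) t 0) * coeff (V.col l) t 0 = (prob (V.col l) t 0 : ℂ) :=
    fun l => Complex.normSq_eq_conj_mul_self.symm
  have hoff := congrFun (congrFun h (i, ⟨0, hn⟩)) (k, ⟨0, hn⟩)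
  rw [Matrix.smul_apply, overlap_gram_apply hs rfl, Matrix.one_apply_ne (by simp [hik])] at hoff
  simp only [Nat.cast_zero, sub_zero, hprob, ← Finset.sum_mul, ← Complex.ofReal_sum, ← hσ,
    smul_eq_mul] at hoff
  exact mul_ne_zero (pow_ne_zero 2 (Complex.ofReal_ne_zero.2 hQ))
    (mul_ne_zero (Complex.ofReal_ne_zero.2 hσ₀)
      (mul_ne_zero (star_ne_zero.2 (hcoeff i)) (hcoeff k))) hoff

end Gram

end Coefficients

section QNumbers

variable {q : ℝ}

lemma qNum_one (t : ℝ) : qNum 1 t = t := if_pos rfl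

lemma qNum_zero (q : ℝ) : qNum q 0 = 0 := by simp [qNum]

lemma qNum_neg (q t : ℝ) : qNum q (-t) = -qNum q t := by
  unfold qNum
  split_ifs
  · rfl
  · rw [neg_neg]; ring

lemma sub_inv_ne_zero (hq : 0 < q) (hq₁ : q ≠ 1) : q - q⁻¹ ≠ 0 := by
  rw [sub_ne_zero]
  intro h
  have hsq : q * q = 1 := by rw [← mul_inv_cancel₀ hq.ne', ← h]
  exact (mul_self_eq_one_iff.1 hsq).elim hq₁ fun hneg => by linarith

lemma qNum_intCast (hq₁ : q ≠ 1) (m : ℤ) :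
    qNum q m = (q ^ m - q ^ (-m)) / (q - q⁻¹) := by
  rw [qNum, if_neg hq₁, ← Int.cast_neg, Real.rpow_intCast, Real.rpow_intCast]

lemma qNum_add_one_mul_sub (hq : 0 < q) (x y : ℤ) :
    qNum q (x + 1) * qNum q y - qNum q x * qNum q (y + 1) = qNum q (y - x) := by
  rcases eq_or_ne q 1 with rfl | hq₁
  · simp only [qNum_one]; ring
  · have hne := sub_inv_ne_zero hq hq₁
    rw_mod_cast [qNum_intCast hq₁, qNum_intCast hq₁, qNum_intCast hq₁, qNum_intCast hq₁,
      qNum_intCast hq₁]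
    rw [div_mul_div_comm, div_mul_div_comm, ← sub_div, div_eq_div_iff (mul_ne_zero hne hne) hne]
    simp only [neg_add, neg_sub, zpow_add₀ hq.ne', zpow_sub₀ hq.ne', zpow_neg, zpow_one]
    field_simp
    ring

lemma qNum_mul_zpow_sub (hq : 0 < q) (u w : ℤ) :
    qNum q u * q ^ w - qNum q w * q ^ u = qNum q (u - w) := by
  rcases eq_or_ne q 1 with rfl | hq₁
  · simp only [qNum_one, one_zpow, mul_one]
  · rw_mod_cast [qNum_intCast hq₁, qNum_intCast hq₁, qNum_intCast hq₁]
    simp only [neg_sub, zpow_sub₀ hq.ne', zpow_neg]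
    field_simp
    ring

lemma qNum_pos (hq : 0 < q) {t : ℝ} (ht : 0 < t) : 0 < qNum q t := by
  rcases lt_trichotomy q 1 with hlt | rfl | hgt
  · rw [qNum, if_neg hlt.ne]
    exact div_pos_of_neg_of_neg
      (sub_neg.2 (Real.rpow_lt_rpow_of_exponent_gt hq hlt (by linarith)))
      (sub_neg.2 (hlt.trans (one_lt_inv₀ hq |>.2 hlt)))
  · rwa [qNum_one]
  · rw [qNum, if_neg hgt.ne']
    exact div_pos (sub_pos.2 (Real.rpow_lt_rpow_of_exponent_lt hgt (by linarith)))
      (sub_pos.2 ((inv_lt_one_of_one_lt₀ hgt).trans hgt))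

end QNumbers

section Ladder

variable {d : ℕ} {q : ℝ}

/-- The matrix element of `X⁺` from `e_a` to `e_{a-1}`, as a function of an integer `a`. -/
noncomputable def ladder (d : ℕ) (q : ℝ) (a : ℤ) : ℝ :=
  Real.sqrt (qNum q a * qNum q (d + 1 - a))

lemma ladder_zero (d : ℕ) (q : ℝ) : ladder d q 0 = 0 := by simp [ladder, qNum_zero]

lemma ladder_reflect (d : ℕ) (q : ℝ) (a : ℤ) : ladder d q (d + 1 - a) = ladder d q a := by
  rw [ladder, ladder, mul_comm]
  push_cast
  rw [sub_sub_cancel]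

lemma ladder_succ (d : ℕ) (q : ℝ) : ladder d q (d + 1) = 0 := by
  rw [← ladder_zero d q, ← ladder_reflect, sub_self]

lemma qNum_nonneg (hq : 0 < q) {t : ℝ} (ht : 0 ≤ t) : 0 ≤ qNum q t := by
  rcases ht.eq_or_lt with rfl | ht
  · rw [qNum_zero]
  · exact (qNum_pos hq ht).le

lemma ladder_sq (hq : 0 < q) {a : ℤ} (ha : 0 ≤ a) (had : a ≤ d + 1) :
    ladder d q a ^ 2 = qNum q a * qNum q (d + 1 - a) := by
  have hle : (a : ℝ) ≤ d + 1 := by exact_mod_cast had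
  exact Real.sq_sqrt (mul_nonneg (qNum_nonneg hq (by exact_mod_cast ha))
    (qNum_nonneg hq (by linarith)))

lemma ladder_pos (hq : 0 < q) {a : ℤ} (ha : 0 < a) (had : a ≤ d) : 0 < ladder d q a := by
  have hle : (a : ℝ) ≤ d := by exact_mod_cast had
  exact Real.sqrt_pos.2 (mul_pos (qNum_pos hq (by exact_mod_cast ha))
    (qNum_pos hq (by linarith)))

lemma raise_apply (a b : Fin (d + 1)) :
    raise d q a b = if (b : ℤ) = (a : ℕ) + 1 then (ladder d q (b : ℕ) : ℂ) else 0 := by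
  have hab : (a : ℕ) + 1 = b ↔ (b : ℤ) = (a : ℕ) + 1 := by omega
  simp only [raise, Matrix.of_apply, ladder, weight, hab]
  congr 5
  · push_cast; ring
  · push_cast; ring

lemma lower_apply (a b : Fin (d + 1)) :
    lower d q a b = if (b : ℤ) = (a : ℕ) - 1 then (ladder d q (a : ℕ) : ℂ) else 0 := by
  have hab : (b : ℤ) = (a : ℕ) - 1 ↔ (a : ℤ) = (b : ℕ) + 1 := by omega
  rw [lower, Matrix.conjTranspose_apply, raise_apply]
  simp only [hab]
  split_ifs <;> simp

lemma sum_raise_mul (a : Fin (d + 1)) (F : ℤ → ℂ)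
    (hF : ∀ t : ℤ, ¬ (0 ≤ t ∧ t < (d + 1 : ℕ)) → F t = 0) :
    ∑ x, raise d q a x * F (x : ℕ) = ladder d q ((a : ℕ) + 1) * F ((a : ℕ) + 1) := by
  simp only [raise_apply]
  refine (sum_fin_eq (fun t => (if t = ((a : ℕ) : ℤ) + 1 then (ladder d q t : ℂ) else 0) * F t)
    ((a : ℕ) + 1) (fun t ht => ?_) (fun ht => ?_)).trans ?_
  · rw [if_neg ht, zero_mul]
  · rw [hF _ ht, mul_zero]
  · rw [if_pos rfl]

lemma sum_lower_mul (a : Fin (d + 1)) (F : ℤ → ℂ)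
    (hF : ∀ t : ℤ, ¬ (0 ≤ t ∧ t < (d + 1 : ℕ)) → F t = 0) :
    ∑ x, lower d q a x * F (x : ℕ) = ladder d q (a : ℕ) * F ((a : ℕ) - 1) := by
  simp only [lower_apply]
  refine (sum_fin_eq (fun t => (if t = ((a : ℕ) : ℤ) - 1 then (ladder d q (a : ℕ) : ℂ) else 0) *
    F t) ((a : ℕ) - 1) (fun t ht => ?_) (fun ht => ?_)).trans ?_
  · rw [if_neg ht, zero_mul]
  · rw [hF _ ht, mul_zero]
  · rw [if_pos rfl]

end Ladder

section Kets

variable {d : ℕ} {q : ℝ}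

/-- The weight `S - a`, as a function of an integer `a`. -/
noncomputable def wt (d : ℕ) (a : ℤ) : ℝ := (d : ℝ) / 2 - a

lemma deltaX_mulVec (X : Op1 d) (v : Fin (d + 1) × Fin (d + 1) → ℂ) (a b : Fin (d + 1)) :
    (deltaX d q X *ᵥ v) (a, b) =
      ((q ^ wt d (b : ℕ) : ℝ) : ℂ) * ∑ x, X a x * v (x, b) +
        ((q ^ (-wt d (a : ℕ)) : ℝ) : ℂ) * ∑ x, X b x * v (a, x) := by
  have hK : ∀ c, q ^ weight d c = q ^ wt d (c : ℕ) := fun c => by simp [wt, weight]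
  have hKinv : ∀ c, q ^ (-weight d c) = q ^ (-wt d (c : ℕ)) := fun c => by simp [wt, weight]
  simp only [deltaX, Matrix.mulVec, dotProduct, Matrix.add_apply, Matrix.kroneckerMap_apply,
    add_mul, Finset.sum_add_distrib, Fintype.sum_prod_type, opK, opKinv, Matrix.diagonal_apply,
    mul_ite, ite_mul, mul_zero, zero_mul, Finset.sum_ite_eq, Finset.mem_univ, if_true, hK, hKinv,
    Finset.mul_sum, Finset.sum_ite_irrel, Finset.sum_const_zero]
  simp only [mul_left_comm, mul_assoc]

lemma zext_deltaX_raise (v : Fin (d + 1) × Fin (d + 1) → ℂ) (a b : ℤ) :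
    zext (deltaX d q (raise d q) *ᵥ v) a b =
      ((q ^ wt d b : ℝ) : ℂ) * (ladder d q (a + 1) * zext v (a + 1) b) +
        ((q ^ (-wt d a) : ℝ) : ℂ) * (ladder d q (b + 1) * zext v a (b + 1)) := by
  refine zext_eq_of (fun a' b' ha hb => ?_) fun hab => ?_
  · subst ha hb
    rw [deltaX_mulVec]
    simp only [← zext_coe v]
    rw [sum_raise_mul a' (fun t => zext v t (b' : ℕ)) fun t ht => zext_eq_zero v fun h => ht h.1,
      sum_raise_mul b' (fun t => zext v (a' : ℕ) t) fun t ht => zext_eq_zero v fun h => ht h.2]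
  · have ha : ladder d q (a + 1) * zext v (a + 1) b = 0 := by
      rcases eq_or_ne a (-1) with rfl | ha
      · simp [ladder_zero]
      · rw [zext_eq_zero v (by omega), mul_zero]
    have hb : ladder d q (b + 1) * zext v a (b + 1) = 0 := by
      rcases eq_or_ne b (-1) with rfl | hb
      · simp [ladder_zero]
      · rw [zext_eq_zero v (by omega), mul_zero]
    rw [ha, hb, mul_zero, mul_zero, add_zero]

lemma zext_deltaX_lower (v : Fin (d + 1) × Fin (d + 1) → ℂ) (a b : ℤ) :
    zext (deltaX d q (lower d q) *ᵥ v) a b =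
      ((q ^ wt d b : ℝ) : ℂ) * (ladder d q a * zext v (a - 1) b) +
        ((q ^ (-wt d a) : ℝ) : ℂ) * (ladder d q b * zext v a (b - 1)) := by
  refine zext_eq_of (fun a' b' ha hb => ?_) fun hab => ?_
  · subst ha hb
    rw [deltaX_mulVec]
    simp only [← zext_coe v]
    rw [sum_lower_mul a' (fun t => zext v t (b' : ℕ)) fun t ht => zext_eq_zero v fun h => ht h.1,
      sum_lower_mul b' (fun t => zext v (a' : ℕ) t) fun t ht => zext_eq_zero v fun h => ht h.2]
  · have ha : ladder d q a * zext v (a - 1) b = 0 := by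
      rcases eq_or_ne a (d + 1) with rfl | ha
      · simp [ladder_succ]
      · rw [zext_eq_zero v (by omega), mul_zero]
    have hb : ladder d q b * zext v a (b - 1) = 0 := by
      rcases eq_or_ne b (d + 1) with rfl | hb
      · simp [ladder_succ]
      · rw [zext_eq_zero v (by omega), mul_zero]
    rw [ha, hb, mul_zero, mul_zero, add_zero]

lemma rpow_mul_rpow_eq_zpow (hq : 0 < q) {x y : ℝ} {k : ℤ} (h : x + y = k) :
    ((q ^ x : ℝ) : ℂ) * ((q ^ y : ℝ) : ℂ) = ((q ^ k : ℝ) : ℂ) := by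
  rw [← Complex.ofReal_mul, ← Real.rpow_add hq, h, Real.rpow_intCast]

lemma zext_deltaX_lower_raise (hq : 0 < q) (v : Fin (d + 1) × Fin (d + 1) → ℂ) (a b : ℤ) :
    zext (deltaX d q (lower d q) *ᵥ (deltaX d q (raise d q) *ᵥ v)) a b =
      ((q ^ (a - b - 1) * (ladder d q a * ladder d q (b + 1)) : ℝ) : ℂ) *
          zext v (a - 1) (b + 1) +
        ((q ^ (a - b + 1) * (ladder d q (a + 1) * ladder d q b) : ℝ) : ℂ) *
          zext v (a + 1) (b - 1) +
        ((q ^ (d - 2 * b) * ladder d q a ^ 2 + q ^ (2 * a - d) * ladder d q b ^ 2 : ℝ) : ℂ) *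
          zext v a b := by
  have hbb := rpow_mul_rpow_eq_zpow hq (x := wt d b) (y := wt d b) (k := d - 2 * b)
    (by simp only [wt]; push_cast; ring)
  have hab := rpow_mul_rpow_eq_zpow hq (x := wt d b) (y := -wt d (a - 1)) (k := a - b - 1)
    (by simp only [wt]; push_cast; ring)
  have hba := rpow_mul_rpow_eq_zpow hq (x := -wt d a) (y := wt d (b - 1)) (k := a - b + 1)
    (by simp only [wt]; push_cast; ring)
  have haa := rpow_mul_rpow_eq_zpow hq (x := -wt d a) (y := -wt d a) (k := 2 * a - d)
    (by simp only [wt]; push_cast; ring)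
  simp only [zext_deltaX_lower, zext_deltaX_raise, sub_add_cancel, Complex.ofReal_add,
    Complex.ofReal_mul, Complex.ofReal_pow, ← hbb, ← hab, ← hba, ← haa]
  ring

lemma suppOn_iff_weight (m : ℤ) (v : Fin (d + 1) × Fin (d + 1) → ℂ) :
    SuppOn v (d - m) ↔ ∀ x, v x ≠ 0 → weight d x.1 + weight d x.2 = m := by
  rw [Prod.forall]
  refine forall₃_congr fun a b _ => ?_
  have hcast : (a : ℤ) + (b : ℕ) = d - m ↔ (a : ℝ) + (b : ℕ) = d - m := by
    rw [← Int.cast_inj (α := ℝ)]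
    push_cast
    rfl
  rw [hcast, weight, weight]
  constructor <;> intro h <;> linarith

lemma diagonal_weight_mulVec_iff {f : ℝ → ℂ} (hf : Function.Injective f) (m : ℤ)
    (v : Fin (d + 1) × Fin (d + 1) → ℂ) :
    Matrix.diagonal (fun x : Fin (d + 1) × Fin (d + 1) => f (weight d x.1 + weight d x.2)) *ᵥ v =
      f m • v ↔ SuppOn v (d - m) := by
  rw [suppOn_iff_weight, funext_iff]
  refine forall_congr' fun x => ?_
  rw [Matrix.mulVec_diagonal, Pi.smul_apply, smul_eq_mul, mul_eq_mul_right_iff, hf.eq_iff,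
    or_iff_not_imp_right]

lemma deltaH_mulVec_iff (m : ℤ) (v : Fin (d + 1) × Fin (d + 1) → ℂ) :
    deltaH d *ᵥ v = (m : ℂ) • v ↔ SuppOn v (d - m) := by
  have hdiag : deltaH d = Matrix.diagonal fun x : Fin (d + 1) × Fin (d + 1) =>
      ((weight d x.1 + weight d x.2 : ℝ) : ℂ) := by
    rw [deltaH, opH, ← Matrix.diagonal_one, Matrix.diagonal_kronecker_diagonal,
      Matrix.diagonal_kronecker_diagonal, Matrix.diagonal_add]
    simp
  rw [hdiag, ← diagonal_weight_mulVec_iff Complex.ofReal_injective, Complex.ofReal_intCast]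

lemma deltaK_mulVec_iff (hq : 0 < q) (hq₁ : q ≠ 1) (m : ℤ)
    (v : Fin (d + 1) × Fin (d + 1) → ℂ) :
    deltaK d q *ᵥ v = ((q ^ m : ℝ) : ℂ) • v ↔ SuppOn v (d - m) := by
  have hdiag : deltaK d q = Matrix.diagonal fun x : Fin (d + 1) × Fin (d + 1) =>
      ((q ^ (weight d x.1 + weight d x.2) : ℝ) : ℂ) := by
    rw [deltaK, opK, Matrix.diagonal_kronecker_diagonal]
    simp [Real.rpow_add hq]
  have hinj : Function.Injective fun t : ℝ => ((q ^ t : ℝ) : ℂ) :=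
    Complex.ofReal_injective.comp fun _ _ => (Real.rpow_right_inj hq hq₁).1
  rw [hdiag, ← diagonal_weight_mulVec_iff hinj, Real.rpow_intCast]

lemma deltaKinv_mulVec (hq : 0 < q) (hq₁ : q ≠ 1) {m : ℤ}
    {v : Fin (d + 1) × Fin (d + 1) → ℂ} (hv : SuppOn v (d - m)) :
    deltaKinv d q *ᵥ v = ((q ^ (-m) : ℝ) : ℂ) • v := by
  have hinv : deltaKinv d q * deltaK d q = 1 := by
    rw [deltaKinv, deltaK, ← Matrix.mul_kronecker_mul, opK, opKinv, Matrix.diagonal_mul_diagonal,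
      ← Matrix.one_kronecker_one]
    simp [← Complex.ofReal_mul, ← Real.rpow_add hq]
  have hK := congrArg (deltaKinv d q *ᵥ ·) ((deltaK_mulVec_iff hq hq₁ m v).2 hv)
  simp only [Matrix.mulVec_mulVec, hinv, Matrix.one_mulVec, Matrix.mulVec_smul] at hK
  conv_rhs => rw [hK]
  rw [smul_smul, ← Complex.ofReal_mul, ← zpow_add₀ hq.ne', neg_add_cancel, zpow_zero,
    Complex.ofReal_one, one_smul]

/-- The eigenvalue of `X⁻ X⁺` on `|J,m⟩_q`. -/
noncomputable def lowerRaise (q : ℝ) (J : ℕ) (m : ℤ) : ℝ :=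
  qNum q J * qNum q (J + 1) - qNum q m * qNum q (m + 1)

lemma deltaCasimirOne_mulVec {m : ℤ} {v : Fin (d + 1) × Fin (d + 1) → ℂ}
    (hv : SuppOn v (d - m)) :
    deltaCasimirOne d *ᵥ v =
      deltaX d 1 (lower d 1) *ᵥ (deltaX d 1 (raise d 1) *ᵥ v) + ((m : ℂ) * (m + 1)) • v := by
  have hH := (deltaH_mulVec_iff m v).2 hv
  rw [deltaCasimirOne, Matrix.add_mulVec, ← Matrix.mulVec_mulVec, ← Matrix.mulVec_mulVec,
    Matrix.add_mulVec, hH, Matrix.one_mulVec, Matrix.mulVec_add, Matrix.mulVec_smul, hH]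
  congr 1
  module

lemma qNum_mul_qNum_add_one (hq : 0 < q) (hq₁ : q ≠ 1) (m : ℤ) :
    qNum q m * qNum q (m + 1) =
      ((q - q⁻¹) ^ 2)⁻¹ * ((q ^ m - q ^ (-m)) * (q * q ^ m - q⁻¹ * q ^ (-m))) := by
  have hsucc : q ^ (m + 1) = q * q ^ m := by rw [zpow_add_one₀ hq.ne', mul_comm]
  have hneg : q ^ (-(m + 1)) = q⁻¹ * q ^ (-m) := by rw [zpow_neg, hsucc, mul_inv, zpow_neg]
  rw_mod_cast [qNum_intCast hq₁, qNum_intCast hq₁]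
  rw [hsucc, hneg, div_mul_div_comm, ← pow_two, div_eq_inv_mul]

lemma deltaCasimir_mulVec (hq : 0 < q) (hq₁ : q ≠ 1) {m : ℤ}
    {v : Fin (d + 1) × Fin (d + 1) → ℂ} (hv : SuppOn v (d - m)) :
    deltaCasimir d q *ᵥ v =
      deltaX d q (lower d q) *ᵥ (deltaX d q (raise d q) *ᵥ v) +
        ((qNum q m * qNum q (m + 1) : ℝ) : ℂ) • v := by
  have hK := (deltaK_mulVec_iff hq hq₁ m v).2 hv
  have hKinv := deltaKinv_mulVec hq hq₁ hv
  rw [deltaCasimir, Matrix.add_mulVec, ← Matrix.mulVec_mulVec, Matrix.smul_mulVec,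
    ← Matrix.mulVec_mulVec, qNum_mul_qNum_add_one hq hq₁]
  simp only [Matrix.sub_mulVec, Matrix.smul_mulVec, hK, hKinv, Matrix.mulVec_sub,
    Matrix.mulVec_smul]
  congr 1
  push_cast
  module

lemma isKet_iff_lower_raise (hq : 0 < q) {J : ℕ} {m : ℤ}
    {v : Fin (d + 1) × Fin (d + 1) → ℂ} :
    IsKet d q J m v ↔ J ≤ d ∧ |m| ≤ (J : ℤ) ∧ star v ⬝ᵥ v = 1 ∧ SuppOn v (d - m) ∧
      deltaX d q (lower d q) *ᵥ (deltaX d q (raise d q) *ᵥ v) =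
        (lowerRaise q J m : ℂ) • v := by
  rw [IsKet]
  refine and_congr_right fun _ => and_congr_right fun _ => and_congr_right fun _ => ?_
  rcases eq_or_ne q 1 with rfl | hq₁
  · simp only [ne_eq, not_true_eq_false, false_imp_iff, and_true, true_imp_iff]
    rw [deltaH_mulVec_iff]
    refine and_congr_right fun hv => ?_
    rw [deltaCasimirOne_mulVec hv, ← eq_sub_iff_add_eq, ← sub_smul]
    simp [lowerRaise, qNum_one]
  · simp only [hq₁, false_imp_iff, true_and, ne_eq, not_false_eq_true, true_imp_iff]
    rw [deltaK_mulVec_iff hq hq₁]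
    refine and_congr_right fun hv => ?_
    rw [deltaCasimir_mulVec hq hq₁ hv, ← eq_sub_iff_add_eq, ← sub_smul, lowerRaise,
      Complex.ofReal_sub]

/-- The coefficients `g c` of `e_{d-m-c} ⊗ e_c` in a vector of weight `m` which is an eigenvector
of `Δ(X⁻) Δ(X⁺)` for the eigenvalue of `|J,m⟩_q`. -/
structure IsCasimirSeq (d : ℕ) (q : ℝ) (J : ℕ) (m : ℤ) (g : ℤ → ℂ) : Prop where
  eq_zero : ∀ c : ℤ, ¬ ((0 ≤ d - m - c ∧ d - m - c ≤ d) ∧ (0 ≤ c ∧ c ≤ d)) → g c = 0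
  step : ∀ a c : ℤ, a + c = d - m →
    ((q ^ (a - c - 1) * (ladder d q a * ladder d q (c + 1)) : ℝ) : ℂ) * g (c + 1) +
      ((q ^ (a - c + 1) * (ladder d q (a + 1) * ladder d q c) : ℝ) : ℂ) * g (c - 1) +
      ((q ^ (d - 2 * c) * ladder d q a ^ 2 + q ^ (2 * a - d) * ladder d q c ^ 2 : ℝ) : ℂ) * g c =
      (lowerRaise q J m : ℂ) * g c

lemma IsCasimirSeq.of_step {J : ℕ} {m : ℤ} {g : ℤ → ℂ}
    (h₀ : ∀ c : ℤ, ¬ ((0 ≤ d - m - c ∧ d - m - c ≤ d) ∧ (0 ≤ c ∧ c ≤ d)) → g c = 0)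
    (hstep : ∀ a c : ℤ, a + c = d - m → 0 ≤ a → a ≤ d → 0 ≤ c → c ≤ d →
      ((q ^ (a - c - 1) * (ladder d q a * ladder d q (c + 1)) : ℝ) : ℂ) * g (c + 1) +
        ((q ^ (a - c + 1) * (ladder d q (a + 1) * ladder d q c) : ℝ) : ℂ) * g (c - 1) +
        ((q ^ (d - 2 * c) * ladder d q a ^ 2 + q ^ (2 * a - d) * ladder d q c ^ 2 : ℝ) : ℂ) *
          g c = (lowerRaise q J m : ℂ) * g c) : IsCasimirSeq d q J m g := by
  refine ⟨h₀, fun a c hac => ?_⟩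
  by_cases hr : (0 ≤ a ∧ a ≤ d) ∧ (0 ≤ c ∧ c ≤ d)
  · exact hstep a c hac hr.1.1 hr.1.2 hr.2.1 hr.2.2
  · have hup : ladder d q a * ladder d q (c + 1) = 0 ∨ g (c + 1) = 0 := by
      by_cases hbd : a = d + 1 ∨ c = -1
      · rcases hbd with rfl | rfl <;> simp [ladder_succ, ladder_zero]
      · exact Or.inr (h₀ _ (by omega))
    have hdown : ladder d q (a + 1) * ladder d q c = 0 ∨ g (c - 1) = 0 := by
      by_cases hbd : a = -1 ∨ c = d + 1
      · rcases hbd with rfl | rfl <;> simp [ladder_succ, ladder_zero]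
      · exact Or.inr (h₀ _ (by omega))
    rw [h₀ c (by omega)]
    rcases hup with hup | hup <;> rcases hdown with hdown | hdown <;> simp [hup, hdown]

lemma lower_raise_mulVec_iff (hq : 0 < q) {J : ℕ} {m : ℤ}
    {v : Fin (d + 1) × Fin (d + 1) → ℂ} (hv : SuppOn v (d - m)) :
    deltaX d q (lower d q) *ᵥ (deltaX d q (raise d q) *ᵥ v) = (lowerRaise q J m : ℂ) • v ↔
      IsCasimirSeq d q J m (coeff v (d - m)) := by
  have hcoeff : ∀ a c : ℤ, a + c = d - m → zext v a c = coeff v (d - m) c := fun a c hac => by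
    rw [coeff, ← hac, add_sub_cancel_right]
  have hentry : ∀ a c : ℤ, a + c = d - m → (zext (deltaX d q (lower d q) *ᵥ
      (deltaX d q (raise d q) *ᵥ v)) a c = zext ((lowerRaise q J m : ℂ) • v) a c ↔ _) :=
    fun a c hac => by
      rw [zext_deltaX_lower_raise hq, zext_smul, hcoeff _ _ hac,
        hcoeff (a - 1) (c + 1) (by omega), hcoeff (a + 1) (c - 1) (by omega)]
  constructor
  · intro h
    exact ⟨fun c hc => coeff_eq_zero v (by omega), fun a c hac => (hentry a c hac).1 (by rw [h])⟩
  · intro h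
    refine zext_injective (funext₂ fun a c => ?_)
    by_cases hac : a + c = d - m
    · exact (hentry a c hac).2 (h.step a c hac)
    · rw [zext_deltaX_lower_raise hq, zext_smul, hv.zext_eq_zero hac,
        hv.zext_eq_zero (a := a - 1) (by omega), hv.zext_eq_zero (a := a + 1) (by omega)]
      simp only [mul_zero, add_zero]

lemma isKet_iff (hq : 0 < q) {J : ℕ} {m : ℤ} {v : Fin (d + 1) × Fin (d + 1) → ℂ} :
    IsKet d q J m v ↔ J ≤ d ∧ |m| ≤ (J : ℤ) ∧ star v ⬝ᵥ v = 1 ∧ SuppOn v (d - m) ∧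
      IsCasimirSeq d q J m (coeff v (d - m)) := by
  rw [isKet_iff_lower_raise hq]
  exact and_congr_right fun _ => and_congr_right fun _ => and_congr_right fun _ =>
    and_congr_right fun hv => lower_raise_mulVec_iff hq hv

end Kets

section Reflection

variable {d : ℕ} {q : ℝ}

lemma ladder_add_one_sq_sub (hq : 0 < q) {a : ℤ} (ha : 0 ≤ a) (had : a ≤ d) :
    ladder d q (a + 1) ^ 2 - ladder d q a ^ 2 = qNum q (d - 2 * a) := by
  have hid := qNum_add_one_mul_sub hq a (d - a)
  rw [ladder_sq hq (by omega) (by omega), ladder_sq hq ha (by omega)]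
  push_cast at hid ⊢
  rw [show (d : ℝ) + 1 - (a + 1) = d - a by ring, show (d : ℝ) + 1 - a = d - a + 1 by ring, hid]
  congr 1
  ring

lemma lowerRaise_neg_sub (hq : 0 < q) (J : ℕ) (m : ℤ) :
    lowerRaise q J (-m) - lowerRaise q J m = qNum q (2 * m) := by
  have hid := qNum_add_one_mul_sub hq (-m) m
  rw [lowerRaise, lowerRaise, two_mul]
  push_cast [sub_neg_eq_add, qNum_neg] at hid ⊢
  linear_combination hid

lemma ladder_sq_reflect (hq : 0 < q) (J : ℕ) {m a c : ℤ} (hac : a + c = d - m)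
    (ha : 0 ≤ a) (had : a ≤ d) (hc : 0 ≤ c) (hcd : c ≤ d) :
    q ^ (2 * a - d) * ladder d q (c + 1) ^ 2 + q ^ (d - 2 * c) * ladder d q (a + 1) ^ 2 -
        lowerRaise q J (-m) =
      q ^ (d - 2 * c) * ladder d q a ^ 2 + q ^ (2 * a - d) * ladder d q c ^ 2 -
        lowerRaise q J m := by
  have ha' := ladder_add_one_sq_sub hq ha had
  have hc' := ladder_add_one_sq_sub hq hc hcd
  have hlow := lowerRaise_neg_sub hq J m
  have hid := qNum_mul_zpow_sub hq (d - 2 * c) (2 * a - d)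
  have hcast : (a : ℝ) + c = d - m := by exact_mod_cast hac
  push_cast at hid
  rw [show (d : ℝ) - 2 * c - (2 * a - d) = 2 * m by linear_combination -2 * hcast,
    show (2 : ℝ) * a - d = -(d - 2 * a) by ring, qNum_neg] at hid
  linear_combination q ^ (2 * a - d) * hc' + q ^ (d - 2 * c) * ha' - hlow + hid

-- The symmetry that exchanges the tensor factors together with the highest and lowest weights.
lemma IsCasimirSeq.reflect (hq : 0 < q) {J : ℕ} {m : ℤ} {g : ℤ → ℂ} (h : IsCasimirSeq d q J m g) :
    IsCasimirSeq d q J (-m) fun c => g (c - m) := by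
  refine .of_step (fun c hc => h.eq_zero _ (by omega)) fun a c hac ha had hc hcd => ?_
  have hladder : ∀ x y : ℤ, x + y = d + 1 → ladder d q x = ladder d q y := fun x y hxy => by
    rw [← ladder_reflect, ← hxy, add_sub_cancel_left]
  have hstep := h.step (d - c) (c - m) (by omega)
  have hdiag := congrArg (fun x : ℝ => (x : ℂ)) <| ladder_sq_reflect hq J hac ha had hc hcd
  rw [hladder (d - c) (c + 1) (by omega), hladder (c - m + 1) a (by omega),
    hladder (d - c + 1) c (by omega), hladder (c - m) (a + 1) (by omega),
    show d - c - (c - m) = a - c by omega, show d - 2 * (c - m) = 2 * a - d by omega,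
    show 2 * (d - c) - d = d - 2 * c by omega] at hstep
  rw [neg_neg] at hdiag
  push_cast at hstep hdiag ⊢
  rw [show c + 1 - m = c - m + 1 by ring, show c - 1 - m = c - m - 1 by ring]
  linear_combination hstep - g (c - m) * hdiag

/-- The permutation of the basis of `ℂⁿ ⊗ ℂⁿ` that exchanges the tensor factors and reverses the
order of the weights in each of them. -/
def reflectPerm (n : ℕ) : Fin n × Fin n ≃ Fin n × Fin n :=
  (Equiv.prodComm _ _).trans (Equiv.prodCongr Fin.revPerm Fin.revPerm)

lemma reflectPerm_apply {n : ℕ} (a b : Fin n) : reflectPerm n (a, b) = (b.rev, a.rev) := rfl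

lemma zext_reflect {n : ℕ} (w : Fin n × Fin n → ℂ) (a b : ℤ) :
    zext (w ∘ reflectPerm n) a b = zext w (n - 1 - b) (n - 1 - a) := by
  refine zext_eq_of (fun a' b' ha hb => ?_) fun hab => zext_eq_zero w (by omega)
  rw [Function.comp_apply, reflectPerm_apply, ← zext_coe w, Fin.val_rev, Fin.val_rev]
  congr 1 <;> omega

lemma SuppOn.reflect {n : ℕ} {w : Fin n × Fin n → ℂ} {s : ℤ} (h : SuppOn w s) :
    SuppOn (w ∘ reflectPerm n) (2 * (n - 1) - s) := fun a b hab => by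
  have hrev := h b.rev a.rev hab
  rw [Fin.val_rev, Fin.val_rev] at hrev
  omega

lemma IsKet.reflect (hq : 0 < q) {J : ℕ} {m : ℤ} {v : Fin (d + 1) × Fin (d + 1) → ℂ}
    (h : IsKet d q J m v) : IsKet d q J (-m) (v ∘ reflectPerm (d + 1)) := by
  obtain ⟨hJ, hm, hunit, hsupp, hchain⟩ := (isKet_iff hq).1 h
  refine (isKet_iff hq).2 ⟨hJ, by rwa [abs_neg], ?_, ?_, ?_⟩
  · rw [← hunit]
    exact comp_equiv_dotProduct_comp_equiv (star v) v (reflectPerm (d + 1))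
  · convert hsupp.reflect using 1
    push_cast
    ring
  · convert hchain.reflect hq using 2 with c
    rw [coeff, coeff, zext_reflect]
    congr 1 <;> push_cast <;> ring

lemma overlap_reflect {n : ℕ} {ι : Type*} (V : Matrix (Fin n × Fin n) ι ℂ) :
    overlap (V.submatrix (reflectPerm n) id) =
      (overlap V)ᴴ.submatrix
        ((Equiv.prodComm _ _).trans (Equiv.prodCongr (Equiv.refl _) Fin.revPerm))
        ((Equiv.prodComm _ _).trans (Equiv.prodCongr Fin.revPerm (Equiv.refl _))) := by
  ext ⟨a, j⟩ ⟨k, c⟩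
  simp only [overlap_apply, Matrix.submatrix_apply, Matrix.conjTranspose_apply, id_eq,
    reflectPerm_apply, star_sum, star_mul', star_star, Equiv.trans_apply, Equiv.prodComm_apply,
    Prod.swap_prod_mk, Equiv.prodCongr_apply, Prod.map_apply, Equiv.refl_apply,
    Fin.revPerm_apply]
  rw [← Equiv.sum_comp Fin.revPerm]
  exact Finset.sum_congr rfl fun b _ => by
    rw [Fin.revPerm_apply, Fin.rev_rev, mul_comm]

lemma IsTLPairWith.reflect (hq : 0 < q) {Q : ℝ} (hQ : Q ≠ 0) {J₁ J₂ : ℕ} {m₁ m₂ : ℤ}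
    (h : IsTLPairWith d q Q J₁ m₁ J₂ m₂) : IsTLPairWith d q Q J₁ (-m₁) J₂ (-m₂) := by
  obtain ⟨v₁, v₂, h₁, h₂, h₁₂, hN⟩ := (isTLPairWith_iff hQ).1 h
  refine (isTLPairWith_iff hQ).2 ⟨_, _, h₁.reflect hq, h₂.reflect hq, ?_, ?_⟩
  · rw [← h₁₂]
    exact comp_equiv_dotProduct_comp_equiv (star v₁) v₂ (reflectPerm (d + 1))
  · have hpair : pairMatrix (v₁ ∘ reflectPerm (d + 1)) (v₂ ∘ reflectPerm (d + 1)) =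
        (pairMatrix v₁ v₂).submatrix (reflectPerm (d + 1)) id := by
      ext x j
      fin_cases j <;> rfl
    rw [← Matrix.mul_smul, Matrix.mul_eq_one_comm_of_equiv (Equiv.prodComm _ _),
      Matrix.smul_mul] at hN
    rw [hpair, overlap_reflect, Matrix.conjTranspose_submatrix, Matrix.submatrix_mul_equiv,
      Matrix.conjTranspose_conjTranspose]
    rw [← Matrix.submatrix_one_equiv ((Equiv.prodComm (Fin 2) (Fin (d + 1))).trans
      (Equiv.prodCongr Fin.revPerm (Equiv.refl (Fin 2)))), ← hN]
    rfl

end Reflection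

section Chains

variable {d : ℕ} {q : ℝ} {J : ℕ} {m : ℤ} {g g' : ℤ → ℂ}

lemma IsCasimirSeq.linear_combination (h : IsCasimirSeq d q J m g) (h' : IsCasimirSeq d q J m g')
    (y z : ℂ) :
    IsCasimirSeq d q J m fun c => y * g c + z * g' c := by
  refine ⟨fun c hc => by rw [h.eq_zero c hc, h'.eq_zero c hc, mul_zero, mul_zero, add_zero],
    fun a c hac => ?_⟩
  linear_combination y * h.step a c hac + z * h'.step a c hac

-- The recurrence determines each coefficient from the next two.
lemma IsCasimirSeq.eq_zero_of_top (hq : 0 < q) (h : IsCasimirSeq d q J m g) (hm : m ≤ 0)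
    (hd : g d = 0) : g = 0 := by
  have hnat : ∀ k : ℕ, g (d - k) = 0 ∧ g (d - k + 1) = 0 := by
    intro k
    induction k with
    | zero =>
      rw [Nat.cast_zero, sub_zero]
      exact ⟨hd, h.eq_zero _ (by omega)⟩
    | succ k ih =>
      rw [Nat.cast_succ, sub_add_eq_sub_sub, sub_add_cancel]
      refine ⟨?_, ih.1⟩
      by_cases hr : (0 ≤ d - m - (d - k - 1) ∧ d - m - (d - k - 1) ≤ d) ∧
          ((0 : ℤ) ≤ d - k - 1 ∧ (d - k - 1 : ℤ) ≤ d)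
      · have hstep := h.step (k - m) (d - k) (by ring)
        rw [ih.1, ih.2, mul_zero, mul_zero, mul_zero, zero_add, add_zero] at hstep
        refine (mul_eq_zero.1 hstep).resolve_left (Complex.ofReal_ne_zero.2 (ne_of_gt ?_))
        exact mul_pos (zpow_pos hq _) (mul_pos (ladder_pos hq (by omega) (by omega))
          (ladder_pos hq (by omega) (by omega)))
      · exact h.eq_zero _ hr
  ext c
  by_cases hc : c ≤ d
  · have hck := (hnat (d - c).toNat).1
    rwa [Int.toNat_of_nonneg (by omega), sub_sub_cancel] at hck
  · exact h.eq_zero c (by omega)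

lemma IsCasimirSeq.swap (h : IsCasimirSeq d 1 J m g) :
    IsCasimirSeq d 1 J m fun c => g (d - m - c) := by
  refine ⟨fun c hc => h.eq_zero _ (by omega), fun a c hac => ?_⟩
  have hstep := h.step c a (by omega)
  obtain rfl : a = d - m - c := by omega
  rw [show d - m - (c + 1) = d - m - c - 1 by ring, show d - m - (c - 1) = d - m - c + 1 by ring]
  push_cast [one_zpow] at hstep ⊢
  linear_combination hstep

lemma IsCasimirSeq.normSq_swap_of_nonpos (h : IsCasimirSeq d 1 J m g) (hm : m ≤ 0) (c : ℤ) :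
    Complex.normSq (g (d - m - c)) = Complex.normSq (g c) := by
  by_cases hd : g d = 0
  · simp [h.eq_zero_of_top one_pos hm hd]
  have hprop : ∀ c, g d * g (d - m - c) = g (-m) * g c := fun c => by
    have hzero := (h.swap.linear_combination h (g d) (-g (-m))).eq_zero_of_top one_pos hm
      (by rw [show d - m - d = -m by ring]; ring)
    rw [← sub_eq_zero, sub_eq_add_neg, ← neg_mul]
    exact congrFun hzero c
  have hd₀ : 0 < Complex.normSq (g d) := Complex.normSq_pos.2 hd
  have hbot : Complex.normSq (g d) = Complex.normSq (g (-m)) := by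
    have hsq := congrArg Complex.normSq (hprop (-m))
    rw [sub_neg_eq_add, sub_add_cancel, map_mul, map_mul] at hsq
    exact (mul_self_inj hd₀.le (Complex.normSq_nonneg _)).1 hsq
  have hsq := congrArg Complex.normSq (hprop c)
  rw [map_mul, map_mul, ← hbot] at hsq
  exact mul_left_cancel₀ hd₀.ne' hsq

lemma IsCasimirSeq.normSq_swap (h : IsCasimirSeq d 1 J m g) (c : ℤ) :
    Complex.normSq (g (d - m - c)) = Complex.normSq (g c) := by
  rcases le_total m 0 with hm | hm
  · exact h.normSq_swap_of_nonpos hm c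
  · have hswap := (h.reflect one_pos).normSq_swap_of_nonpos (by omega) (c + m)
    rwa [add_sub_cancel_right, sub_neg_eq_add, add_sub_add_right_eq_sub, sub_right_comm] at hswap

lemma ladder_one_sq {a : ℤ} (ha : 0 ≤ a) (had : a ≤ d + 1) :
    ladder d 1 a ^ 2 = a * (d + 1 - a) := by
  rw [ladder_sq one_pos ha had, qNum_one, qNum_one]

lemma normSq_of_three_term {r t x y : ℝ} {u v w : ℂ} (hr : r ≠ 0) (hv : (r : ℂ) * v = x * u)
    (hw : (r : ℂ) * u + t * w = y * v) (hu : u ≠ 0)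
    (huv : Complex.normSq v = Complex.normSq u) :
    t ^ 2 * Complex.normSq w = (y - x) ^ 2 * Complex.normSq u := by
  have hrx : r ^ 2 = x ^ 2 := by
    have hsq := congrArg Complex.normSq hv
    rw [map_mul, map_mul, huv, Complex.normSq_ofReal, Complex.normSq_ofReal, ← pow_two,
      ← pow_two] at hsq
    exact mul_right_cancel₀ (Complex.normSq_pos.2 hu).ne' hsq
  have hrx' : (r : ℂ) ^ 2 = x ^ 2 := by exact_mod_cast hrx
  have hrw : (r : ℂ) * (t * w) = x * ((y - x : ℝ) * u) := by
    push_cast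
    linear_combination r * hw + y * hv - u * hrx'
  have hsq := congrArg Complex.normSq hrw
  simp only [map_mul, Complex.normSq_ofReal, ← pow_two] at hsq
  rw [← hrx] at hsq
  exact mul_left_cancel₀ (pow_ne_zero 2 hr) hsq

-- The recurrences at the two uppermost indices, with the Casimir eigenvalue eliminated.
lemma IsCasimirSeq.normSq_top_edge (h : IsCasimirSeq d 1 J m g) (hd : g d ≠ 0)
    (hd₁ : Complex.normSq (g (d - 1)) = Complex.normSq (g d)) :
    ((d : ℝ) - 1) * (2 - m) * (d + m - 1) * Complex.normSq (g (d - 2)) =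
      2 * (d + m - 1) ^ 2 * Complex.normSq (g d) := by
  obtain ⟨hm, hmd⟩ : 0 ≤ -m ∧ 1 - m ≤ d := by
    have hd₁' : g (d - 1) ≠ 0 := by rwa [← Complex.normSq_pos, hd₁, Complex.normSq_pos]
    have hrange := mt (h.eq_zero d) hd
    have hrange' := mt (h.eq_zero (d - 1)) hd₁'
    omega
  have hr : ladder d 1 (1 - m) * ladder d 1 d ≠ 0 :=
    (mul_pos (ladder_pos one_pos (by omega) hmd) (ladder_pos one_pos (by omega) le_rfl)).ne'
  have hstep := h.step (-m) d (by ring)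
  have hstep' := h.step (1 - m) (d - 1) (by ring)
  rw [ladder_succ, show -m + 1 = 1 - m by ring] at hstep
  rw [show 1 - m + 1 = 2 - m by ring, sub_add_cancel, show (d : ℤ) - 1 - 1 = d - 2 by ring]
    at hstep'
  have hedge := normSq_of_three_term hr (w := g (d - 2))
    (t := ladder d 1 (2 - m) * ladder d 1 (d - 1))
    (x := lowerRaise 1 J m - (ladder d 1 (-m) ^ 2 + ladder d 1 d ^ 2))
    (y := lowerRaise 1 J m - (ladder d 1 (1 - m) ^ 2 + ladder d 1 (d - 1) ^ 2))
    (by push_cast [one_zpow] at hstep ⊢; linear_combination hstep)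
    (by push_cast [one_zpow] at hstep' ⊢; linear_combination hstep') hd hd₁
  simp only [mul_pow, ladder_one_sq (d := d) (a := -m) (by omega) (by omega),
    ladder_one_sq (d := d) (a := 1 - m) (by omega) (by omega),
    ladder_one_sq (d := d) (a := 2 - m) (by omega) (by omega),
    ladder_one_sq (d := d) (a := d) (by omega) (by omega),
    ladder_one_sq (d := d) (a := d - 1) (by omega) (by omega)] at hedge
  push_cast at hedge
  linear_combination hedge / 2

end Chains

section Relations

variable {d : ℕ} {q Q : ℝ} {J₁ J₂ : ℕ} {m₁ m₂ : ℤ}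

lemma suppOn_pairMatrix {n : ℕ} {v₁ v₂ : Fin n × Fin n → ℂ} {s₁ s₂ : ℤ} (h₁ : SuppOn v₁ s₁)
    (h₂ : SuppOn v₂ s₂) (i : Fin 2) : SuppOn ((pairMatrix v₁ v₂).col i) (![s₁, s₂] i) := by
  fin_cases i
  · exact h₁
  · exact h₂

lemma IsKet.suppOn (hq : 0 < q) {J : ℕ} {m : ℤ} {v : Fin (d + 1) × Fin (d + 1) → ℂ}
    (h : IsKet d q J m v) : SuppOn v (d - m) := ((isKet_iff hq).1 h).2.2.2.1

lemma IsKet.isCasimirSeq (hq : 0 < q) {J : ℕ} {m : ℤ} {v : Fin (d + 1) × Fin (d + 1) → ℂ}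
    (h : IsKet d q J m v) : IsCasimirSeq d q J m (coeff v (d - m)) := ((isKet_iff hq).1 h).2.2.2.2

lemma IsTLPairWith.weight_ne (hq : 0 < q) (hQ : Q ≠ 0) (h : IsTLPairWith d q Q J₁ m₁ J₂ m₂) :
    m₁ ≠ m₂ := by
  rintro rfl
  obtain ⟨v₁, v₂, h₁, h₂, -, hN⟩ := (isTLPairWith_iff hQ).1 h
  have hs : ∀ i, SuppOn ((pairMatrix v₁ v₂).col i) (d - m₁) :=
    Fin.forall_fin_two.2 ⟨h₁.suppOn hq, h₂.suppOn hq⟩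
  exact not_subsingleton (Fin 2) (subsingleton_of_suppOn_const hs d.succ_pos hQ hN)

lemma IsTLPairWith.exists_prob_relations (hq : 0 < q) (hQ : Q ≠ 0)
    (h : IsTLPairWith d q Q J₁ m₁ J₂ m₂) :
    ∃ v₁ v₂ : Fin (d + 1) × Fin (d + 1) → ℂ, IsKet d q J₁ m₁ v₁ ∧ IsKet d q J₂ m₂ v₂ ∧
      ∀ c : ℤ, 0 ≤ c → c ≤ d →
        prob v₁ (d - m₁) c * prob v₁ (d - m₁) (d - m₁ - c) +
            prob v₂ (d - m₂) c * prob v₁ (d - m₁) (d - m₂ - c) = Q⁻¹ ^ 2 ∧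
          prob v₁ (d - m₁) c * prob v₂ (d - m₂) (d - m₁ - c) +
            prob v₂ (d - m₂) c * prob v₂ (d - m₂) (d - m₂ - c) = Q⁻¹ ^ 2 := by
  obtain ⟨v₁, v₂, h₁, h₂, -, hN⟩ := (isTLPairWith_iff hQ).1 h
  refine ⟨v₁, v₂, h₁, h₂, fun c hc hcd => ?_⟩
  have hrel := fun i => prob_relation (suppOn_pairMatrix (h₁.suppOn hq) (h₂.suppOn hq)) hN i hc
    (by push_cast; omega)
  simp only [Fin.sum_univ_two] at hrel
  exact ⟨hrel 0, hrel 1⟩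

end Relations

section Classification

/-- The properties of the squared moduli `p c` of the coefficients of `e_{d-m-c} ⊗ e_c` in a vector
`|J,m⟩₁` that do not involve `J`. -/
structure IsProfile (d : ℕ) (m : ℤ) (p : ℤ → ℝ) : Prop where
  nonneg : ∀ c, 0 ≤ p c
  eq_zero : ∀ c : ℤ, ¬ ((0 ≤ d - m - c ∧ d - m - c ≤ d) ∧ (0 ≤ c ∧ c ≤ d)) → p c = 0
  symm : ∀ c, p (d - m - c) = p c
  edge : p d ≠ 0 → p (d - 1) = p d →
    ((d : ℝ) - 1) * (2 - m) * (d + m - 1) * p (d - 2) = 2 * (d + m - 1) ^ 2 * p d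

lemma IsCasimirSeq.isProfile {d J : ℕ} {m : ℤ} {g : ℤ → ℂ} (h : IsCasimirSeq d 1 J m g) :
    IsProfile d m fun c => Complex.normSq (g c) where
  nonneg c := Complex.normSq_nonneg _
  eq_zero c hc := by rw [h.eq_zero c hc, map_zero]
  symm := h.normSq_swap
  edge hd := h.normSq_top_edge (mt Complex.normSq_eq_zero.2 hd)

lemma IsCasimirSeq.isProfile_reflect {d J : ℕ} {m : ℤ} {g : ℤ → ℂ} (h : IsCasimirSeq d 1 J m g) :
    IsProfile d (-m) fun c => Complex.normSq (g (d - c)) := by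
  convert (h.reflect one_pos).isProfile using 2 with c
  rw [← h.normSq_swap (c - m), sub_sub_sub_cancel_right]

namespace IsProfile

variable {d : ℕ} {m : ℤ} {p : ℤ → ℝ}

lemma of_ne_zero (h : IsProfile d m p) {c : ℤ} (hc : p c ≠ 0) :
    (0 ≤ d - m - c ∧ d - m - c ≤ d) ∧ (0 ≤ c ∧ c ≤ d) :=
  not_not.1 (mt (h.eq_zero c) hc)

lemma eq_one_sub (h : IsProfile d m p) (hd : p d ≠ 0) (hd₁ : p (d - 1) = p d)
    (hd₂ : p (d - 2) = 0) : m = 1 - d := by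
  have hedge := h.edge hd hd₁
  rw [hd₂, mul_zero, eq_comm, mul_eq_zero, or_iff_left hd, mul_eq_zero,
    or_iff_right two_ne_zero, sq_eq_zero_iff] at hedge
  have hcast : (m : ℝ) = 1 - d := by linear_combination hedge
  exact_mod_cast hcast

lemma eq_zero_of_three (h : IsProfile d m p) (hd : p d ≠ 0) (hd₁ : p (d - 1) = p d)
    (hd₂ : p (d - 2) = p d) : m = 0 := by
  have hrange := h.of_ne_zero (hd₂ ▸ hd)
  have hedge := h.edge hd hd₁
  rw [hd₂] at hedge
  have hfactor : (((d + m - 1) * ((d + 1) * m) : ℤ) : ℝ) = 0 := by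
    push_cast
    linear_combination -mul_right_cancel₀ hd hedge
  have hfactor' : (d + m - 1) * ((d + 1) * m) = 0 := by exact_mod_cast hfactor
  refine ((mul_eq_zero.1 hfactor').resolve_left (by omega) |> mul_eq_zero.1).resolve_left ?_
  omega

end IsProfile

/-- The squared moduli of the coefficients of two vectors `|J₁,m₁⟩₁` and `|J₂,m₂⟩₁`, subject to the
diagonal entries of the Temperley-Lieb relations; `κ` stands for `Q⁻¹`. The reversal of `p₂` makes
the definition symmetric under the reflection of both weights. -/
structure IsModuliPair (d : ℕ) (m₁ m₂ : ℤ) (κ : ℝ) (p₁ p₂ : ℤ → ℝ) : Prop where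
  pos : 0 < κ
  lt : m₁ < m₂
  profile₁ : IsProfile d m₁ p₁
  profile₂ : IsProfile d (-m₂) fun c => p₂ (d - c)
  rel₁ : ∀ c : ℤ, 0 ≤ c → c ≤ d → p₁ c ^ 2 + p₂ c * p₁ (c + (m₂ - m₁)) = κ ^ 2
  rel₂ : ∀ c : ℤ, 0 ≤ c → c ≤ d → p₂ c ^ 2 + p₁ c * p₂ (c - (m₂ - m₁)) = κ ^ 2

namespace IsModuliPair

variable {d : ℕ} {m₁ m₂ : ℤ} {κ : ℝ} {p₁ p₂ : ℤ → ℝ}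

lemma flip (h : IsModuliPair d m₁ m₂ κ p₁ p₂) :
    IsModuliPair d (-m₂) (-m₁) κ (fun c => p₂ (d - c)) fun c => p₁ (d - c) where
  pos := h.pos
  lt := neg_lt_neg h.lt
  profile₁ := h.profile₂
  profile₂ := by simpa only [neg_neg, sub_sub_cancel] using h.profile₁
  rel₁ c hc hcd := by
    rw [← h.rel₂ (d - c) (by omega) (by omega), neg_sub_neg, sub_add_eq_sub_sub]
  rel₂ c hc hcd := by
    rw [← h.rel₁ (d - c) (by omega) (by omega), neg_sub_neg, sub_sub_eq_add_sub,
      add_sub_right_comm]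

lemma eq₁ (h : IsModuliPair d m₁ m₂ κ p₁ p₂) {c : ℤ} (hc : 0 ≤ c) (hcd : c ≤ d)
    (hzero : p₂ c = 0 ∨ p₁ (c + (m₂ - m₁)) = 0) : p₁ c = κ := by
  have hrel := h.rel₁ c hc hcd
  rw [mul_eq_zero.2 hzero, add_zero] at hrel
  exact (pow_left_inj₀ (h.profile₁.nonneg c) h.pos.le two_ne_zero).1 hrel

lemma eq₂ (h : IsModuliPair d m₁ m₂ κ p₁ p₂) {c : ℤ} (hc : 0 ≤ c) (hcd : c ≤ d)
    (hzero : p₁ c = 0 ∨ p₂ (c - (m₂ - m₁)) = 0) : p₂ c = κ := by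
  have hflip := h.flip.eq₁ (c := d - c) (by omega) (by omega)
  rw [neg_sub_neg, sub_add_eq_sub_sub, sub_sub_cancel] at hflip
  exact hflip hzero

lemma top (h : IsModuliPair d m₁ m₂ κ p₁ p₂) {c : ℤ} (hc : 0 ≤ c) (hcd : c ≤ d)
    (hlt : d < c + (m₂ - m₁)) : p₁ c = κ :=
  h.eq₁ hc hcd (Or.inr (h.profile₁.eq_zero _ (by omega)))

lemma bottom (h : IsModuliPair d m₁ m₂ κ p₁ p₂) {c : ℤ} (hc : 0 ≤ c) (hcd : c ≤ d)
    (hlt : c < m₂ - m₁) : p₂ c = κ := by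
  have hflip := h.flip.top (c := d - c) (by omega) (by omega) (by omega)
  rwa [sub_sub_cancel] at hflip

lemma top_eq (h : IsModuliPair d m₁ m₂ κ p₁ p₂) : p₁ d = κ :=
  h.top (by omega) le_rfl (by have := h.lt; omega)

lemma weight₁_nonpos (h : IsModuliPair d m₁ m₂ κ p₁ p₂) : m₁ ≤ 0 := by
  have := h.profile₁.of_ne_zero (h.top_eq.trans_ne h.pos.ne')
  omega

lemma weight₂_nonneg (h : IsModuliPair d m₁ m₂ κ p₁ p₂) : 0 ≤ m₂ :=
  neg_nonpos.1 h.flip.weight₁_nonpos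

lemma weight₁_eq_zero_of_lt (h : IsModuliPair d m₁ m₂ κ p₁ p₂) (hlt : d < m₂ - m₁) : m₁ = 0 := by
  have := h.profile₁.of_ne_zero ((h.top le_rfl (by omega) (by omega)).trans_ne h.pos.ne')
  have := h.weight₁_nonpos
  omega

lemma sub_le (h : IsModuliPair d m₁ m₂ κ p₁ p₂) : m₂ - m₁ ≤ d := by
  by_contra! hlt
  have h₁ := h.weight₁_eq_zero_of_lt hlt
  have h₂ := h.flip.weight₁_eq_zero_of_lt (by omega)
  omega

lemma weight₁_eq_zero_of_three_le (h : IsModuliPair d m₁ m₂ κ p₁ p₂) (hδ : 3 ≤ m₂ - m₁) :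
    m₁ = 0 := by
  have hle := h.sub_le
  refine h.profile₁.eq_zero_of_three (h.top_eq.trans_ne h.pos.ne') ?_ ?_
  · rw [h.top_eq, h.top (by omega) (by omega) (by omega)]
  · rw [h.top_eq, h.top (by omega) (by omega) (by omega)]

lemma sub_lt_three (h : IsModuliPair d m₁ m₂ κ p₁ p₂) : m₂ - m₁ < 3 := by
  by_contra! hδ
  have h₁ := h.weight₁_eq_zero_of_three_le hδ
  have h₂ := h.flip.weight₁_eq_zero_of_three_le (by omega)
  omega

lemma weight₁_ne_zero (h : IsModuliPair d m₁ m₂ κ p₁ p₂) (hδ : m₂ - m₁ = 2) : m₁ ≠ 0 := by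
  intro hm
  have hle := h.sub_le
  have hbottom : p₂ 0 = κ := h.bottom le_rfl (by omega) (by omega)
  have hzero : p₁ 0 = κ := by rw [← h.top_eq, ← h.profile₁.symm d, hm]; ring_nf
  have htwo : p₁ 2 = 0 := by
    have hrel := h.rel₁ 0 le_rfl (by omega)
    rw [hzero, hbottom, hδ, zero_add, add_eq_left, mul_eq_zero, or_iff_right h.pos.ne'] at hrel
    exact hrel
  have := h.profile₁.eq_one_sub (h.top_eq.trans_ne h.pos.ne')
    (by rw [h.top_eq, h.top (by omega) (by omega) (by omega)])
    (by rw [← htwo, ← h.profile₁.symm 2, hm, sub_zero])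
  omega

lemma of_sub_eq_two (h : IsModuliPair d m₁ m₂ κ p₁ p₂) (hδ : m₂ - m₁ = 2) :
    d = 2 ∧ m₁ = -1 ∧ m₂ = 1 := by
  have hle := h.sub_le
  obtain rfl : m₁ = -1 := by
    have h₁ := h.weight₁_ne_zero hδ
    have h₂ := h.flip.weight₁_ne_zero (by omega)
    have := h.weight₁_nonpos
    have := h.weight₂_nonneg
    omega
  have hbottom : p₂ 1 = κ := h.bottom zero_le_one (by omega) (by omega)
  have hone : p₁ 1 = κ := by rw [← h.top_eq, ← h.profile₁.symm d]; ring_nf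
  have hthree : p₁ 3 = 0 := by
    have hrel := h.rel₁ 1 zero_le_one (by omega)
    rw [hone, hbottom, hδ, add_eq_left, mul_eq_zero, or_iff_right h.pos.ne'] at hrel
    exact hrel
  have := h.profile₁.eq_one_sub (h.top_eq.trans_ne h.pos.ne')
    (by rw [h.top_eq, h.top (by omega) (by omega) (by omega)])
    (by rw [← hthree, ← h.profile₁.symm 3]; ring_nf)
  omega

lemma of_sub_eq_one (h : IsModuliPair d m₁ m₂ κ p₁ p₂) (hδ : m₂ - m₁ = 1) (hm₂ : m₂ ≠ 0) :
    d = 2 ∧ m₁ = 0 ∧ m₂ = 1 ∧ p₁ 1 = 0 := by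
  have hle := h.sub_le
  have := h.weight₁_nonpos
  have := h.weight₂_nonneg
  obtain rfl : m₁ = 0 := by omega
  obtain rfl : m₂ = 1 := by omega
  have hbottom : p₂ 0 = κ := h.bottom le_rfl (by omega) (by omega)
  have hzero : p₁ 0 = κ := by rw [← h.top_eq, ← h.profile₁.symm d]; ring_nf
  have hone : p₁ 1 = 0 := by
    have hrel := h.rel₁ 0 le_rfl (by omega)
    rw [hzero, hbottom, add_eq_left, mul_eq_zero, or_iff_right h.pos.ne'] at hrel
    exact hrel
  have hone' : p₂ 1 = κ := h.eq₂ zero_le_one (by omega) (Or.inl hone)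
  have hd : 2 ≤ (d : ℤ) := by
    by_contra! hlt
    obtain hd₁ : (d : ℤ) = 1 := by omega
    exact h.pos.ne' (by rw [← h.top_eq, hd₁, hone])
  have htwo : p₂ 2 = 0 := by
    have hrel₁ := h.rel₁ 1 zero_le_one (by omega)
    have hrel₂ := h.rel₂ 2 zero_le_two hd
    rw [← pow_eq_zero_iff two_ne_zero]
    norm_num only [hone] at hrel₁ hrel₂
    linarith
  have := h.profile₂.eq_one_sub (by simpa only [sub_self, hbottom] using h.pos.ne')
    (by simp only [sub_sub_cancel, sub_self, hbottom, hone'])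
    (by simpa only [sub_sub_cancel] using htwo)
  exact ⟨by omega, rfl, rfl, hone⟩

theorem classification (h : IsModuliPair d m₁ m₂ κ p₁ p₂) :
    d = 2 ∧ (m₁ = -1 ∧ m₂ = 1 ∨ m₁ = -1 ∧ m₂ = 0 ∧ p₂ 1 = 0 ∨ m₁ = 0 ∧ m₂ = 1 ∧ p₁ 1 = 0) := by
  have hlt := h.lt
  have hlt₃ := h.sub_lt_three
  obtain hδ | hδ : m₂ - m₁ = 1 ∨ m₂ - m₁ = 2 := by omega
  · rcases eq_or_ne m₂ 0 with hm₂ | hm₂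
    · obtain ⟨rfl, -, hm₁, hp⟩ := h.flip.of_sub_eq_one (by omega) (by omega)
      exact ⟨rfl, Or.inr (Or.inl ⟨neg_eq_iff_eq_neg.1 hm₁, hm₂, hp⟩)⟩
    · obtain ⟨hd, hmp⟩ := h.of_sub_eq_one hδ hm₂
      exact ⟨hd, Or.inr (Or.inr hmp)⟩
  · obtain ⟨hd, hm⟩ := h.of_sub_eq_two hδ
    exact ⟨hd, Or.inl hm⟩

end IsModuliPair

end Classification

section AtOne

variable {d : ℕ} {Q : ℝ} {J J₁ J₂ : ℕ} {m₁ m₂ : ℤ}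

lemma IsCasimirSeq.mul_succ_eq {g : ℤ → ℂ} (h : IsCasimirSeq d 1 J 0 g) (hd : g d ≠ 0)
    (hd₁ : g (d - 1) = 0) : J * (J + 1) = d := by
  have hstep := h.step 0 d (by ring)
  simp only [hd₁, h.eq_zero (d + 1) (by omega), mul_zero, zero_add] at hstep
  have hcasimir := mul_right_cancel₀ hd hstep
  have hladder := ladder_one_sq (d := d) (a := d) (by omega) (by omega)
  simp only [one_zpow, one_mul, ladder_zero, lowerRaise, qNum_one, hladder] at hcasimir
  have hcast : ((J * (J + 1) : ℕ) : ℝ) = d := by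
    rw [Complex.ofReal_inj] at hcasimir
    push_cast at hcasimir ⊢
    linear_combination -hcasimir
  exact_mod_cast hcast

lemma IsTLPairWith.exists_isModuliPair (hQ : 0 < Q) (h : IsTLPairWith d 1 Q J₁ m₁ J₂ m₂)
    (hlt : m₁ < m₂) :
    ∃ g₁ g₂ : ℤ → ℂ, IsCasimirSeq d 1 J₁ m₁ g₁ ∧ IsCasimirSeq d 1 J₂ m₂ g₂ ∧
      IsModuliPair d m₁ m₂ Q⁻¹ (fun c => Complex.normSq (g₁ c)) fun c => Complex.normSq (g₂ c) := by
  obtain ⟨v₁, v₂, h₁, h₂, hrel⟩ := h.exists_prob_relations one_pos hQ.ne'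
  have hg₁ := h₁.isCasimirSeq one_pos
  have hg₂ := h₂.isCasimirSeq one_pos
  refine ⟨_, _, hg₁, hg₂, inv_pos.2 hQ, hlt, hg₁.isProfile, hg₂.isProfile_reflect,
    fun c hc hcd => ?_, fun c hc hcd => ?_⟩
  · rw [← (hrel c hc hcd).1, show c + (m₂ - m₁) = d - m₁ - (d - m₂ - c) by ring, pow_two]
    simp only [prob, hg₁.normSq_swap]
  · rw [← (hrel c hc hcd).2, show c - (m₂ - m₁) = d - m₂ - (d - m₁ - c) by ring, pow_two, add_comm]
    simp only [prob, hg₂.normSq_swap]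

lemma IsTLPairWith.classification (hQ : 0 < Q) (h : IsTLPairWith d 1 Q J₁ m₁ J₂ m₂)
    (hlt : m₁ < m₂) :
    d = 2 ∧ (m₁ = -1 ∧ m₂ = 1 ∨ m₁ = -1 ∧ m₂ = 0 ∧ J₂ = 1 ∨ m₁ = 0 ∧ J₁ = 1 ∧ m₂ = 1) := by
  have eq_one_of_mul_succ : ∀ J : ℕ, J * (J + 1) = 2 → J = 1 := fun J hJ => by nlinarith
  obtain ⟨g₁, g₂, hg₁, hg₂, hmod⟩ := h.exists_isModuliPair hQ hlt
  have htop := hmod.top_eq.trans_ne hmod.pos.ne'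
  have hbottom := hmod.flip.top_eq.trans_ne hmod.pos.ne'
  obtain ⟨rfl, hm | ⟨hm₁, rfl, hp⟩ | ⟨rfl, hm₂, hp⟩⟩ := hmod.classification
  · exact ⟨rfl, Or.inl hm⟩
  · have hd : Complex.normSq (g₂ (2 : ℕ)) ≠ 0 := by
      rw [← hg₂.normSq_swap]
      exact hbottom
    exact ⟨rfl, Or.inr (Or.inl ⟨hm₁, rfl, eq_one_of_mul_succ _
      (hg₂.mul_succ_eq (mt Complex.normSq_eq_zero.2 hd) (Complex.normSq_eq_zero.1 hp))⟩)⟩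
  · exact ⟨rfl, Or.inr (Or.inr ⟨rfl, eq_one_of_mul_succ _
      (hg₁.mul_succ_eq (mt Complex.normSq_eq_zero.2 htop) (Complex.normSq_eq_zero.1 hp)), hm₂⟩)⟩

end AtOne

section Construction

variable {d : ℕ} {q Q : ℝ} {J J₁ J₂ : ℕ} {m m₁ m₂ : ℤ}

lemma IsCasimirSeq.coeff_eq {g : ℤ → ℂ} (h : IsCasimirSeq d q J m g)
    {w : Fin (d + 1) × Fin (d + 1) → ℂ}
    (hw : ∀ a b : Fin (d + 1), (a : ℤ) + (b : ℕ) = d - m → w (a, b) = g (b : ℕ)) :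
    coeff w (d - m) = g := by
  ext c
  refine zext_eq_of (fun a b ha hb => ?_) fun hc => h.eq_zero c (by omega)
  rw [hw a b (by omega), hb]

lemma IsCasimirSeq.smul {g : ℤ → ℂ} (h : IsCasimirSeq d q J m g) (z : ℂ) :
    IsCasimirSeq d q J m (z • g) := by
  have hlin := h.linear_combination h z 0
  simp only [zero_mul, add_zero] at hlin
  exact hlin

lemma coeff_smul {n : ℕ} (z : ℂ) (w : Fin n × Fin n → ℂ) (s : ℤ) :
    coeff (z • w) s = z • coeff w s :=
  funext fun _ => zext_smul ..

lemma SuppOn.smul {n : ℕ} {w : Fin n × Fin n → ℂ} {s : ℤ} (h : SuppOn w s) (z : ℂ) :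
    SuppOn (z • w) s :=
  fun a b hab => h a b (right_ne_zero_of_mul hab)

open ComplexOrder in
lemma IsCasimirSeq.exists_isKet (hq : 0 < q) (hJ : J ≤ d) (hm : |m| ≤ (J : ℤ)) {g : ℤ → ℂ}
    (h : IsCasimirSeq d q J m g) (hg : g ≠ 0) : ∃ v, IsKet d q J m v := by
  set w : Fin (d + 1) × Fin (d + 1) → ℂ := fun x =>
    if (x.1 : ℤ) + (x.2 : ℕ) = d - m then g (x.2 : ℕ) else 0
  have hcoeff : coeff w (d - m) = g := h.coeff_eq fun a b hab => if_pos hab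
  have hsupp : SuppOn w (d - m) := fun a b hab => by_contra fun hne => hab (if_neg hne)
  have hw : w ≠ 0 := by
    rintro hw
    refine hg (hcoeff ▸ funext fun c => ?_)
    rw [hw, ← zero_smul ℂ 0, coeff_smul, zero_smul]
  set r : ℝ := ∑ c : Fin (d + 1), prob w (d - m) (c : ℕ)
  have hr : star w ⬝ᵥ w = (r : ℂ) := hsupp.star_dotProduct_self
  have hr₀ : r ≠ 0 := fun h₀ => hw (dotProduct_star_self_eq_zero.1
    (by rw [hr, h₀, Complex.ofReal_zero]))
  have hr_nonneg : 0 ≤ r := Finset.sum_nonneg fun _ _ => Complex.normSq_nonneg _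
  refine ⟨((√r)⁻¹ : ℂ) • w, (isKet_iff hq).2 ⟨hJ, hm, ?_, hsupp.smul _, ?_⟩⟩
  · rw [star_smul, smul_dotProduct, dotProduct_smul, hr, smul_eq_mul, smul_eq_mul, star_inv₀,
      Complex.star_def, Complex.conj_ofReal, ← Complex.ofReal_inv, ← Complex.ofReal_mul,
      ← Complex.ofReal_mul, Complex.ofReal_eq_one]
    rw [← mul_assoc, ← mul_inv, Real.mul_self_sqrt hr_nonneg, inv_mul_cancel₀ hr₀]
  · rw [coeff_smul, hcoeff]
    exact h.smul _

lemma dotProduct_eq_zero_of_suppOn {n : ℕ} {v₁ v₂ : Fin n × Fin n → ℂ} {s₁ s₂ : ℤ}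
    (h₁ : SuppOn v₁ s₁) (h₂ : SuppOn v₂ s₂) (hs : s₁ ≠ s₂) : star v₁ ⬝ᵥ v₂ = 0 := by
  refine Finset.sum_eq_zero fun ⟨a, b⟩ _ => ?_
  rw [Pi.star_apply, mul_eq_zero, star_eq_zero]
  by_contra! hne
  exact hs ((h₁ a b hne.1).symm.trans (h₂ a b hne.2))

lemma isTLPairWith_of_prob (hq : 0 < q) (hQ : Q ≠ 0) (hm : m₁ ≠ m₂)
    {v₁ v₂ : Fin (d + 1) × Fin (d + 1) → ℂ} (h₁ : IsKet d q J₁ m₁ v₁) (h₂ : IsKet d q J₂ m₂ v₂)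
    (hdiag : ∀ c : ℤ, 0 ≤ c → c ≤ d →
      prob v₁ (d - m₁) c * prob v₁ (d - m₁) (d - m₁ - c) +
          prob v₂ (d - m₂) c * prob v₁ (d - m₁) (d - m₂ - c) = Q⁻¹ ^ 2 ∧
        prob v₁ (d - m₁) c * prob v₂ (d - m₂) (d - m₁ - c) +
          prob v₂ (d - m₂) c * prob v₂ (d - m₂) (d - m₂ - c) = Q⁻¹ ^ 2)
    (hoff : ∀ c c' : ℤ, c' - c = m₂ - m₁ →
      (prob v₁ (d - m₁) c = 0 ∨ prob v₁ (d - m₁) c' = 0 ∨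
          prob v₁ (d - m₁) (d - m₁ - c) = 0 ∨ prob v₂ (d - m₂) (d - m₁ - c') = 0) ∧
        (prob v₂ (d - m₂) c = 0 ∨ prob v₂ (d - m₂) c' = 0 ∨
          prob v₁ (d - m₁) (d - m₂ - c) = 0 ∨ prob v₂ (d - m₂) (d - m₂ - c') = 0)) :
    IsTLPairWith d q Q J₁ m₁ J₂ m₂ := by
  have hs := suppOn_pairMatrix (h₁.suppOn hq) (h₂.suppOn hq)
  refine (isTLPairWith_iff hQ).2 ⟨v₁, v₂, h₁, h₂, dotProduct_eq_zero_of_suppOn (h₁.suppOn hq)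
    (h₂.suppOn hq) (by omega), gram_eq_one_of_prob hs hQ (fun i c hc hcd => ?_)
    fun i k hik j c c' hcc' => ?_⟩
  · rw [Fin.sum_univ_two]
    fin_cases i
    · exact (hdiag c hc (by omega)).1
    · exact (hdiag c hc (by omega)).2
  · have hoff₀₁ : ∀ j : Fin 2, ∀ c c' : ℤ, c' - c = m₂ - m₁ →
        prob ((pairMatrix v₁ v₂).col j) (![d - m₁, d - m₂] j) c = 0 ∨
          prob ((pairMatrix v₁ v₂).col j) (![d - m₁, d - m₂] j) c' = 0 ∨
          prob v₁ (d - m₁) (![d - m₁, d - m₂] j - c) = 0 ∨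
          prob v₂ (d - m₂) (![d - m₁, d - m₂] j - c') = 0 := by
      intro j c c' hcc'
      fin_cases j
      · exact (hoff c c' hcc').1
      · exact (hoff c c' hcc').2
    fin_cases i <;> fin_cases k
    · exact absurd rfl hik
    · have h₀₁ : (d : ℤ) - m₁ + c = d - m₂ + c' := hcc'
      exact hoff₀₁ j c c' (by omega)
    · have h₁₀ : (d : ℤ) - m₂ + c = d - m₁ + c' := hcc'
      have hswap := hoff₀₁ j c' c (by omega)
      tauto
    · exact absurd rfl hik

end Construction

section SpinOne

variable {q Q : ℝ} {J J₁ J₂ : ℕ}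

lemma qNum_one_right (hq : 0 < q) : qNum q 1 = 1 := by
  rcases eq_or_ne q 1 with rfl | hq₁
  · exact qNum_one 1
  · rw [qNum, if_neg hq₁, Real.rpow_one, Real.rpow_neg_one, div_self (sub_inv_ne_zero hq hq₁)]

lemma qNum_two (hq : 0 < q) : qNum q 2 = q + q⁻¹ := by
  have hid := qNum_mul_zpow_sub hq 1 (-1)
  push_cast at hid
  rw [qNum_neg, qNum_one_right hq] at hid
  norm_num at hid
  linear_combination -hid

lemma qNum_three (hq : 0 < q) : qNum q 3 = q ^ 2 + 1 + (q ^ 2)⁻¹ := by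
  have hid := qNum_mul_zpow_sub hq 2 (-1)
  push_cast at hid
  rw [qNum_neg, qNum_one_right hq, qNum_two hq] at hid
  norm_num at hid
  rw [← hid]
  field_simp
  ring

/-- For `J = 1, 2` and spin one, the coefficient of `e₂ ⊗ e₁` in `|J,-1⟩_q` is the coefficient of
`e₁ ⊗ e₂` multiplied by `(-1) ^ J * tilt q J`. -/
noncomputable def tilt (q : ℝ) (J : ℕ) : ℝ := (q ^ 2) ^ (2 * J - 3 : ℤ)

lemma tilt_pos (hq : 0 < q) (J : ℕ) : 0 < tilt q J := zpow_pos (pow_pos hq 2) _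

lemma tilt_one (q : ℝ) : tilt q 1 = (q ^ 2)⁻¹ := by norm_num [tilt]

lemma tilt_two (q : ℝ) : tilt q 2 = q ^ 2 := by norm_num [tilt]

lemma tilt_add_inv (hJ : J = 1 ∨ J = 2) : tilt q J + (tilt q J)⁻¹ = q ^ 2 + (q ^ 2)⁻¹ := by
  rcases hJ with rfl | rfl
  · rw [tilt_one, inv_inv, add_comm]
  · rw [tilt_two]

lemma ladder_two_sq (hq : 0 < q) {a : ℤ} (ha : a = 1 ∨ a = 2) : ladder 2 q a ^ 2 = q + q⁻¹ := by
  rw [ladder_sq hq (by omega) (by push_cast; omega)]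
  rcases ha with rfl | rfl <;> norm_num [qNum_two hq, qNum_one_right hq]

lemma lowerRaise_neg_one (hq : 0 < q) (hJ : J = 1 ∨ J = 2) :
    lowerRaise q J (-1) = (q + q⁻¹) * (1 + q ^ 2 + (-1) ^ J * (tilt q J)⁻¹) := by
  have hneg : qNum q ((-1 : ℤ) + 1) = 0 := by norm_num [qNum_zero]
  rw [lowerRaise, hneg, mul_zero, sub_zero]
  rcases hJ with rfl | rfl
  · norm_num [tilt_one, qNum_one_right hq, qNum_two hq]
  · norm_num [tilt_two, qNum_two hq, qNum_three hq]
    exact Or.inl (add_comm _ _)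

lemma tilt_sub_inv (hJ : J = 1 ∨ J = 2) :
    (-1) ^ J * (tilt q J - (tilt q J)⁻¹) = q ^ 2 - (q ^ 2)⁻¹ := by
  rcases hJ with rfl | rfl
  · rw [tilt_one, inv_inv, pow_one, neg_one_mul, neg_sub]
  · rw [tilt_two, neg_one_sq, one_mul]

lemma isCasimirSeq_neg_one_iff (hq : 0 < q) (hJ : J = 1 ∨ J = 2) {g : ℤ → ℂ} :
    IsCasimirSeq 2 q J (-1) g ↔
      (∀ c, c ≠ 1 → c ≠ 2 → g c = 0) ∧ g 1 = (-1) ^ J * tilt q J * g 2 := by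
  have h₁ : ladder 2 q 1 * ladder 2 q 1 = q + q⁻¹ := by
    rw [← pow_two, ladder_two_sq hq (Or.inl rfl)]
  have h₂ : ladder 2 q 2 * ladder 2 q 2 = q + q⁻¹ := by
    rw [← pow_two, ladder_two_sq hq (Or.inr rfl)]
  have hlr := lowerRaise_neg_one hq hJ
  have hsign : ((-1 : ℂ) ^ J) * (-1) ^ J = 1 := by rw [← mul_pow]; simp
  have ht : (tilt q J : ℂ) * (tilt q J : ℂ)⁻¹ = 1 :=
    mul_inv_cancel₀ (Complex.ofReal_ne_zero.2 (tilt_pos hq J).ne')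
  have hqq : ((q + q⁻¹ : ℝ) : ℂ) ≠ 0 := Complex.ofReal_ne_zero.2 (by positivity)
  have hsub : (((-1) ^ J * (tilt q J - (tilt q J)⁻¹) : ℝ) : ℂ) = (q ^ 2 - (q ^ 2)⁻¹ : ℝ) := by
    rw [tilt_sub_inv hJ]
  push_cast at hsub hqq
  constructor
  · intro h
    refine ⟨fun c h₁ h₂ => h.eq_zero c (by push_cast; omega), ?_⟩
    have hstep := h.step 2 1 (by norm_num)
    norm_num [h.eq_zero 0 (by norm_num), pow_two, h₁, h₂, hlr] at hstep
    have hinv : g 2 = (-1) ^ J * (tilt q J : ℂ)⁻¹ * g 1 :=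
      mul_left_cancel₀ hqq (by linear_combination hstep)
    rw [hinv]
    linear_combination (-g 1) * hsign - (-1) ^ J * (-1) ^ J * g 1 * ht
  · rintro ⟨h₀, h⟩
    refine IsCasimirSeq.of_step (fun c hc => h₀ c (by omega) (by omega))
      fun a c hac ha had hc hcd => ?_
    obtain ⟨rfl, rfl⟩ | ⟨rfl, rfl⟩ : a = 2 ∧ c = 1 ∨ a = 1 ∧ c = 2 := by push_cast at *; omega
    · norm_num [h₀ 0, pow_two, h₁, h₂, hlr]
      rw [h]
      linear_combination (-(q + (q : ℂ)⁻¹) * g 2) * hsign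
        - (q + (q : ℂ)⁻¹) * g 2 * (-1) ^ J * (-1) ^ J * ht
    · norm_num [h₀ 3, pow_two, h₁, h₂, hlr]
      rw [h]
      linear_combination (q + (q : ℂ)⁻¹) * g 2 * hsub

lemma isCasimirSeq_one_zero_iff (hq : 0 < q) {g : ℤ → ℂ} :
    IsCasimirSeq 2 q 1 0 g ↔
      (∀ c, c ≠ 0 → c ≠ 1 → c ≠ 2 → g c = 0) ∧ g 2 = -g 0 ∧ g 1 = (q⁻¹ - q : ℝ) * g 0 := by
  have hladder : ladder 2 q 1 = ladder 2 q 2 := by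
    rw [← ladder_reflect]
    norm_num
  have h₂ : ladder 2 q 2 * ladder 2 q 2 = q + q⁻¹ := by
    rw [← pow_two, ladder_two_sq hq (Or.inr rfl)]
  have hlr : lowerRaise q 1 0 = q + q⁻¹ := by
    norm_num [lowerRaise, qNum_zero, qNum_one_right hq, qNum_two hq]
  have hqC : (q : ℂ) ≠ 0 := Complex.ofReal_ne_zero.2 hq.ne'
  have hqq : ((q + q⁻¹ : ℝ) : ℂ) ≠ 0 := Complex.ofReal_ne_zero.2 (by positivity)
  push_cast at hqq
  constructor
  · intro h
    refine ⟨fun c h₀ h₁ h₂ => h.eq_zero c (by push_cast; omega), ?_⟩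
    have hstep₀ := h.step 2 0 (by norm_num)
    have hstep₁ := h.step 1 1 (by norm_num)
    norm_num [h.eq_zero (-1) (by norm_num), pow_two, ladder_zero, hladder, h₂, hlr] at hstep₀ hstep₁
    have hg₁ : g 1 = (q⁻¹ - q : ℝ) * g 0 := by
      refine mul_left_cancel₀ (mul_ne_zero hqC hqq) ?_
      push_cast
      linear_combination hstep₀ - (q + (q : ℂ)⁻¹) * g 0 * mul_inv_cancel₀ hqC
    refine ⟨mul_left_cancel₀ hqq ?_, hg₁⟩
    rw [hg₁] at hstep₁
    push_cast at hstep₁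
    linear_combination q * hstep₁ - (q + (q : ℂ)⁻¹) * (g 0 + g 2) * mul_inv_cancel₀ hqC
  · rintro ⟨h₀, h2, h1⟩
    refine IsCasimirSeq.of_step (fun c hc => h₀ c (by omega) (by omega) (by omega))
      fun a c hac ha had hc hcd => ?_
    obtain ⟨rfl, rfl⟩ | ⟨rfl, rfl⟩ | ⟨rfl, rfl⟩ :
      a = 2 ∧ c = 0 ∨ a = 1 ∧ c = 1 ∨ a = 0 ∧ c = 2 := by push_cast at *; omega
    all_goals norm_num [ladder_zero, h₀ (-1), h₀ 3, pow_two, hladder, h₂, hlr, h2, h1]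
    all_goals field_simp
    all_goals ring

lemma IsKet.sum_prob {d : ℕ} {m : ℤ} (hq : 0 < q) {v : Fin (d + 1) × Fin (d + 1) → ℂ}
    (h : IsKet d q J m v) : ∑ c : Fin (d + 1), prob v (d - m) (c : ℕ) = 1 := by
  rw [← Complex.ofReal_inj, ← (h.suppOn hq).star_dotProduct_self, h.2.2.1, Complex.ofReal_one]

lemma IsKet.prob_neg_one (hq : 0 < q) (hJ : J = 1 ∨ J = 2) {v : Fin 3 × Fin 3 → ℂ}
    (h : IsKet 2 q J (-1) v) (c : ℤ) :
    prob v 3 c = if c = 1 then tilt q J / (q ^ 2 + (q ^ 2)⁻¹)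
      else if c = 2 then (tilt q J)⁻¹ / (q ^ 2 + (q ^ 2)⁻¹) else 0 := by
  have ht := tilt_pos hq J
  obtain ⟨hzero, h₁⟩ := (isCasimirSeq_neg_one_iff hq hJ).1 (h.isCasimirSeq hq)
  have hsum : prob v 3 0 + prob v 3 1 + prob v 3 2 = 1 :=
    (Fin.sum_univ_three _).symm.trans (h.sum_prob hq)
  norm_num at hzero h₁
  have hp₀ : ∀ c, c ≠ 1 → c ≠ 2 → prob v 3 c = 0 := fun c hc₁ hc₂ => by
    rw [prob, hzero c hc₁ hc₂, map_zero]
  have hp₁ : prob v 3 1 = tilt q J ^ 2 * prob v 3 2 := by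
    rw [prob, h₁]
    simp [prob, pow_two]
  have hp₂ : prob v 3 2 = (tilt q J)⁻¹ / (q ^ 2 + (q ^ 2)⁻¹) := by
    rw [hp₀ 0 (by norm_num) (by norm_num), hp₁] at hsum
    rw [← tilt_add_inv hJ, eq_div_iff (by positivity)]
    field_simp
    linear_combination hsum
  split_ifs with hc₁ hc₂
  · rw [hc₁, hp₁, hp₂]
    field_simp
  · rw [hc₂, hp₂]
  · exact hp₀ c hc₁ hc₂

lemma IsKet.prob_one (hq : 0 < q) (hJ : J = 1 ∨ J = 2) {v : Fin 3 × Fin 3 → ℂ}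
    (h : IsKet 2 q J 1 v) (c : ℤ) :
    prob v 1 c = if c = 0 then tilt q J / (q ^ 2 + (q ^ 2)⁻¹)
      else if c = 1 then (tilt q J)⁻¹ / (q ^ 2 + (q ^ 2)⁻¹) else 0 := by
  have hreflect : prob v 1 c = prob (v ∘ reflectPerm 3) 3 (c + 1) := by
    rw [prob, prob, coeff, coeff, zext_reflect]
    congr 2 <;> push_cast <;> ring
  rw [hreflect, (h.reflect hq).prob_neg_one hq hJ]
  simp only [add_eq_right, show c + 1 = 2 ↔ c = 1 by omega]

lemma IsKet.prob_zero (hq : 0 < q) {v : Fin 3 × Fin 3 → ℂ} (h : IsKet 2 q 1 0 v) (c : ℤ) :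
    prob v 2 c = if c = 0 ∨ c = 2 then 1 / (q ^ 2 + (q ^ 2)⁻¹)
      else if c = 1 then (q⁻¹ - q) ^ 2 / (q ^ 2 + (q ^ 2)⁻¹) else 0 := by
  obtain ⟨hzero, h₂, h₁⟩ := (isCasimirSeq_one_zero_iff hq).1 (h.isCasimirSeq hq)
  have hsum : prob v 2 0 + prob v 2 1 + prob v 2 2 = 1 :=
    (Fin.sum_univ_three _).symm.trans (h.sum_prob hq)
  norm_num at hzero h₁ h₂
  have hp₂ : prob v 2 2 = prob v 2 0 := by rw [prob, h₂, Complex.normSq_neg, prob]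
  have hp₁ : prob v 2 1 = (q⁻¹ - q) ^ 2 * prob v 2 0 := by
    rw [prob, h₁, Complex.normSq_mul, ← Complex.ofReal_inv, ← Complex.ofReal_sub,
      Complex.normSq_ofReal, pow_two, prob]
  have hp₀ : prob v 2 0 = 1 / (q ^ 2 + (q ^ 2)⁻¹) := by
    rw [hp₁, hp₂] at hsum
    rw [eq_div_iff (by positivity), ← hsum]
    field_simp
    ring
  split_ifs with hc hc₁
  · rcases hc with rfl | rfl
    · exact hp₀
    · rw [hp₂, hp₀]
  · rw [hc₁, hp₁, hp₀, mul_one_div]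
  · rw [prob, hzero c (by omega) hc₁ (by omega), map_zero]

lemma exists_isKet_neg_one (hq : 0 < q) (hJ : J = 1 ∨ J = 2) : ∃ v, IsKet 2 q J (-1) v := by
  refine IsCasimirSeq.exists_isKet hq (by omega) (by norm_num; omega) (g := fun c =>
    if c = 1 then (-1) ^ J * tilt q J else if c = 2 then 1 else 0)
    ((isCasimirSeq_neg_one_iff hq hJ).2 ⟨fun c hc₁ hc₂ => by simp [hc₁, hc₂], by simp⟩) fun h => ?_
  simpa using congrFun h 2

lemma exists_isKet_one (hq : 0 < q) (hJ : J = 1 ∨ J = 2) : ∃ v, IsKet 2 q J 1 v :=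
  let ⟨_, hv⟩ := exists_isKet_neg_one hq hJ
  ⟨_, hv.reflect hq⟩

lemma exists_isKet_zero (hq : 0 < q) : ∃ v, IsKet 2 q 1 0 v := by
  refine IsCasimirSeq.exists_isKet hq (by norm_num) (by norm_num) (g := fun c =>
    if c = 0 then 1 else if c = 1 then (q⁻¹ - q : ℝ) else if c = 2 then -1 else 0)
    ((isCasimirSeq_one_zero_iff hq).2 ⟨fun c hc₀ hc₁ hc₂ => by simp [hc₀, hc₁, hc₂], by simp,
      by simp⟩) fun h => ?_
  simpa using congrFun h 0

lemma div_mul_div_eq_inv_sq_iff {K x y : ℝ} (hK : 0 < K) :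
    x / K * (y / K) = (K ^ 2)⁻¹ ↔ x * y = 1 := by
  rw [div_mul_div_comm, ← pow_two, div_eq_iff (by positivity), inv_mul_cancel₀ (by positivity)]

lemma eq_of_div_mul_inv_div_eq {K x : ℝ} (hK : 0 < K) (hQ : 0 < Q) (hx : x ≠ 0)
    (h : x / K * (x⁻¹ / K) = (Q ^ 2)⁻¹) : Q = K := by
  rw [(div_mul_div_eq_inv_sq_iff hK).2 (mul_inv_cancel₀ hx), inv_inj] at h
  exact (pow_left_inj₀ hK.le hQ.le two_ne_zero).1 h |>.symm

lemma isTLPairWith_neg_one_one_iff (hq : 0 < q) (hQ : 0 < Q) (hJ₁ : J₁ = 1 ∨ J₁ = 2)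
    (hJ₂ : J₂ = 1 ∨ J₂ = 2) :
    IsTLPairWith 2 q Q J₁ (-1) J₂ 1 ↔ Q = q ^ 2 + (q ^ 2)⁻¹ ∧ tilt q J₁ * tilt q J₂ = 1 := by
  have ht₁ := (tilt_pos hq J₁).ne'
  have ht₂ := (tilt_pos hq J₂).ne'
  have hK : 0 < q ^ 2 + (q ^ 2)⁻¹ := by positivity
  constructor
  · intro h
    obtain ⟨v₁, v₂, h₁, h₂, hrel⟩ := h.exists_prob_relations hq hQ.ne'
    obtain ⟨hxy, hone⟩ := hrel 0 (by norm_num) (by norm_num)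
    norm_num [h₁.prob_neg_one hq hJ₁, h₂.prob_one hq hJ₂] at hxy hone
    obtain rfl := eq_of_div_mul_inv_div_eq hK hQ ht₂ hone
    exact ⟨rfl, by rwa [div_mul_div_eq_inv_sq_iff hK, mul_comm] at hxy⟩
  · rintro ⟨rfl, hxy⟩
    obtain ⟨v₁, h₁⟩ := exists_isKet_neg_one hq hJ₁
    obtain ⟨v₂, h₂⟩ := exists_isKet_one hq hJ₂
    refine isTLPairWith_of_prob hq hQ.ne' (by norm_num) h₁ h₂ (fun c hc hcd => ?_)
      fun c c' hcc' => ?_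
    · norm_num at hcd
      norm_num [h₁.prob_neg_one hq hJ₁, h₂.prob_one hq hJ₂]
      interval_cases c <;> norm_num [div_mul_div_eq_inv_sq_iff hK, ht₁, ht₂, ← mul_inv, hxy]
      rwa [mul_comm]
    · obtain rfl : c' = c + 2 := by omega
      have hzero₁ : ∀ c, c < 1 ∨ 2 < c → prob v₁ (2 - -1) c = 0 := fun c hc =>
        prob_eq_zero v₁ (by push_cast; omega)
      have hzero₂ : ∀ c, c < 0 ∨ 1 < c → prob v₂ (2 - 1) c = 0 := fun c hc =>
        prob_eq_zero v₂ (by push_cast; omega)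
      refine ⟨?_, ?_⟩
      · rcases lt_or_ge c 1 with hc | hc
        · exact Or.inl (hzero₁ _ (by omega))
        · exact Or.inr (Or.inl (hzero₁ _ (by omega)))
      · rcases lt_or_ge c 0 with hc | hc
        · exact Or.inl (hzero₂ _ (by omega))
        · exact Or.inr (Or.inl (hzero₂ _ (by omega)))

lemma tilt_eq_one_iff (hq : 0 < q) (hJ : J = 1 ∨ J = 2) : tilt q J = 1 ↔ q = 1 := by
  rcases hJ with rfl | rfl
  · rw [tilt_one, inv_eq_one, pow_eq_one_iff_of_nonneg hq.le two_ne_zero]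
  · rw [tilt_two, pow_eq_one_iff_of_nonneg hq.le two_ne_zero]

lemma isTLPairWith_neg_one_zero_iff (hq : 0 < q) (hQ : 0 < Q) (hJ : J = 1 ∨ J = 2) :
    IsTLPairWith 2 q Q J (-1) 1 0 ↔ Q = q ^ 2 + (q ^ 2)⁻¹ ∧ q = 1 := by
  have hK : 0 < q ^ 2 + (q ^ 2)⁻¹ := by positivity
  constructor
  · intro h
    obtain ⟨v₁, v₂, h₁, h₂, hrel⟩ := h.exists_prob_relations hq hQ.ne'
    obtain ⟨htilt, hone⟩ := hrel 0 (by norm_num) (by norm_num)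
    norm_num [h₁.prob_neg_one hq hJ, h₂.prob_zero hq, -one_div] at htilt hone
    obtain rfl := eq_of_div_mul_inv_div_eq (x := 1) hK hQ one_ne_zero (by rwa [inv_one])
    rw [div_mul_div_eq_inv_sq_iff hK, one_mul, inv_eq_one, tilt_eq_one_iff hq hJ] at htilt
    exact ⟨rfl, htilt⟩
  · rintro ⟨rfl, rfl⟩
    obtain ⟨v₁, h₁⟩ := exists_isKet_neg_one one_pos hJ
    obtain ⟨v₂, h₂⟩ := exists_isKet_zero one_pos
    have htilt : tilt 1 J = 1 := (tilt_eq_one_iff one_pos hJ).2 rfl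
    refine isTLPairWith_of_prob hq hQ.ne' (by norm_num) h₁ h₂ (fun c hc hcd => ?_)
      fun c c' hcc' => ?_
    · norm_num at hcd
      norm_num [h₁.prob_neg_one hq hJ, h₂.prob_zero hq, htilt]
      interval_cases c <;> norm_num
    · obtain rfl : c' = c + 1 := by omega
      have hzero₁ : ∀ c, c < 1 ∨ 2 < c → prob v₁ (2 - -1) c = 0 := fun c hc =>
        prob_eq_zero v₁ (by push_cast; omega)
      have hzero₂ : ∀ c, c ≠ 0 → c ≠ 2 → prob v₂ (2 - 0) c = 0 := fun c hc₀ hc₂ => by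
        norm_num [h₂.prob_zero hq, hc₀, hc₂]
      refine ⟨?_, ?_⟩
      · rcases lt_trichotomy c 1 with hc | rfl | hc
        · exact Or.inl (hzero₁ _ (by omega))
        · exact Or.inr (Or.inr (Or.inr (hzero₂ _ (by norm_num) (by norm_num))))
        · exact Or.inr (Or.inl (hzero₁ _ (by omega)))
      · by_cases hc : c = 0 ∨ c = 2
        · exact Or.inr (Or.inl (hzero₂ _ (by omega) (by omega)))
        · exact Or.inl (hzero₂ _ (by omega) (by omega))

end SpinOne

section Labels

variable {d J J₁ J₂ : ℕ} {m m₁ m₂ : ℤ} {q Q : ℝ}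

/-- The labels `J, m` of the vectors that occur in TL pairs: all those of spin one with
`J = 1, 2` and `|m| ≤ 1`, except for `|2,0⟩`. -/
def IsTLLabel (J : ℕ) (m : ℤ) : Prop :=
  (J = 1 ∨ J = 2) ∧ (m = -1 ∨ m = 1) ∨ J = 1 ∧ m = 0

lemma isTLPairWith_comm : IsTLPairWith d q Q J₁ m₁ J₂ m₂ ↔ IsTLPairWith d q Q J₂ m₂ J₁ m₁ :=
  ⟨IsTLPairWith.symm, IsTLPairWith.symm⟩

lemma isTLPairWith_neg_iff (hq : 0 < q) (hQ : Q ≠ 0) :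
    IsTLPairWith d q Q J₁ (-m₁) J₂ (-m₂) ↔ IsTLPairWith d q Q J₁ m₁ J₂ m₂ :=
  ⟨fun h => neg_neg m₁ ▸ neg_neg m₂ ▸ h.reflect hq hQ, fun h => h.reflect hq hQ⟩

lemma tilt_mul_tilt_eq_one_iff (hq : 0 < q) (hJ₁ : J₁ = 1 ∨ J₁ = 2) (hJ₂ : J₂ = 1 ∨ J₂ = 2) :
    tilt q J₁ * tilt q J₂ = 1 ↔ q = 1 ∨ J₁ ≠ J₂ := by
  rcases eq_or_ne J₁ J₂ with rfl | hne
  · rw [← pow_two, pow_eq_one_iff_of_nonneg (tilt_pos hq J₁).le two_ne_zero,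
      tilt_eq_one_iff hq hJ₁]
    simp
  · have hq₂ : q ^ 2 ≠ 0 := (pow_pos hq 2).ne'
    have hprod : tilt q J₁ * tilt q J₂ = 1 := by
      obtain ⟨rfl, rfl⟩ | ⟨rfl, rfl⟩ : J₁ = 1 ∧ J₂ = 2 ∨ J₁ = 2 ∧ J₂ = 1 := by omega
      · rw [tilt_one, tilt_two, inv_mul_cancel₀ hq₂]
      · rw [tilt_one, tilt_two, mul_inv_cancel₀ hq₂]
    simp [hprod, hne]

lemma isTLPairWith_two_iff (hq : 0 < q) (hQ : 0 < Q) (h₁ : IsTLLabel J₁ m₁)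
    (h₂ : IsTLLabel J₂ m₂) (hm : m₁ ≠ m₂) :
    IsTLPairWith 2 q Q J₁ m₁ J₂ m₂ ↔
      Q = q ^ 2 + (q ^ 2)⁻¹ ∧ (q = 1 ∨ J₁ ≠ J₂ ∧ m₁ + m₂ = 0) := by
  wlog hlt : m₁ < m₂ generalizing J₁ m₁ J₂ m₂
  · rw [isTLPairWith_comm, this h₂ h₁ hm.symm (by omega), add_comm m₂, ne_comm]
  obtain ⟨hJ₁, rfl⟩ | ⟨rfl, rfl⟩ : (J₁ = 1 ∨ J₁ = 2) ∧ m₁ = -1 ∨ J₁ = 1 ∧ m₁ = 0 := by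
    unfold IsTLLabel at h₁ h₂; omega
  · obtain ⟨hJ₂, rfl⟩ | ⟨rfl, rfl⟩ : (J₂ = 1 ∨ J₂ = 2) ∧ m₂ = 1 ∨ J₂ = 1 ∧ m₂ = 0 := by
      unfold IsTLLabel at h₁ h₂; omega
    · rw [isTLPairWith_neg_one_one_iff hq hQ hJ₁ hJ₂, tilt_mul_tilt_eq_one_iff hq hJ₁ hJ₂]
      simp
    · rw [isTLPairWith_neg_one_zero_iff hq hQ hJ₁]
      simp
  · obtain ⟨hJ₂, rfl⟩ : (J₂ = 1 ∨ J₂ = 2) ∧ m₂ = 1 := by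
      unfold IsTLLabel at h₁ h₂; omega
    rw [isTLPairWith_comm, ← isTLPairWith_neg_iff hq hQ.ne', neg_zero,
      isTLPairWith_neg_one_zero_iff hq hQ hJ₂]
    simp

lemma IsTLPairWith.isTLLabel (hQ : 0 < Q) (h : IsTLPairWith d 1 Q J₁ m₁ J₂ m₂) :
    d = 2 ∧ m₁ ≠ m₂ ∧ IsTLLabel J₁ m₁ ∧ IsTLLabel J₂ m₂ := by
  have hm := h.weight_ne one_pos hQ.ne'
  wlog hlt : m₁ < m₂ generalizing J₁ m₁ J₂ m₂
  · obtain ⟨hd, -, h₂, h₁⟩ := this h.symm hm.symm (by omega)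
    exact ⟨hd, hm, h₁, h₂⟩
  obtain ⟨-, -, -, ⟨hJ₁, hm₁, -⟩, ⟨hJ₂, hm₂, -⟩, -⟩ := id h
  rw [abs_le] at hm₁ hm₂
  obtain ⟨rfl, hcases⟩ := h.classification hQ hlt
  refine ⟨rfl, hm, ?_, ?_⟩
  · unfold IsTLLabel; omega
  · unfold IsTLLabel; omega

lemma isTLPairWith_at_one_iff (hQ : 0 < Q) :
    IsTLPairWith d 1 Q J₁ m₁ J₂ m₂ ↔
      Q = 2 ∧ d = 2 ∧ m₁ ≠ m₂ ∧ IsTLLabel J₁ m₁ ∧ IsTLLabel J₂ m₂ := by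
  have htwo : (1 : ℝ) ^ 2 + (1 ^ 2)⁻¹ = 2 := by norm_num
  constructor
  · intro h
    obtain ⟨rfl, hm, h₁, h₂⟩ := h.isTLLabel hQ
    exact ⟨htwo ▸ ((isTLPairWith_two_iff one_pos hQ h₁ h₂ hm).1 h).1, rfl, hm, h₁, h₂⟩
  · rintro ⟨rfl, rfl, hm, h₁, h₂⟩
    exact (isTLPairWith_two_iff one_pos hQ h₁ h₂ hm).2 ⟨htwo.symm, Or.inl rfl⟩

lemma isTLPair_at_one_iff :
    IsTLPair d 1 J₁ m₁ J₂ m₂ ↔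
      d = 2 ∧ m₁ ≠ m₂ ∧ IsTLLabel J₁ m₁ ∧ IsTLLabel J₂ m₂ := by
  constructor
  · rintro ⟨Q, hQ, h⟩
    exact h.isTLLabel hQ
  · exact fun h => ⟨2, two_pos, (isTLPairWith_at_one_iff two_pos).2 ⟨rfl, h⟩⟩

lemma forall_isTLPair_iff :
    (∀ q : ℝ, 0 < q → IsTLPair d q J₁ m₁ J₂ m₂) ↔
      d = 2 ∧ m₁ ≠ m₂ ∧ IsTLLabel J₁ m₁ ∧ IsTLLabel J₂ m₂ ∧ J₁ ≠ J₂ ∧ m₁ + m₂ = 0 := by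
  constructor
  · intro h
    obtain ⟨rfl, hm, h₁, h₂⟩ := isTLPair_at_one_iff.1 (h 1 one_pos)
    obtain ⟨Q, hQ, hTL⟩ := h 2 two_pos
    have hopp := ((isTLPairWith_two_iff two_pos hQ h₁ h₂ hm).1 hTL).2
    exact ⟨rfl, hm, h₁, h₂, hopp.resolve_left (by norm_num)⟩
  · rintro ⟨rfl, hm, h₁, h₂, hopp⟩ q hq
    have hK : 0 < q ^ 2 + (q ^ 2)⁻¹ := by positivity
    exact ⟨_, hK, (isTLPairWith_two_iff hq hK h₁ h₂ hm).2 ⟨rfl, Or.inr hopp⟩⟩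

lemma isTLLabel_pair_iff :
    m₁ ≠ m₂ ∧ IsTLLabel J₁ m₁ ∧ IsTLLabel J₂ m₂ ↔
      ∃ m : ℤ, (m = 1 ∨ m = -1) ∧
        (s((J₁, m₁), (J₂, m₂)) = s((1, m), (1, -m)) ∨
         s((J₁, m₁), (J₂, m₂)) = s((1, m), (1, 0)) ∨
         s((J₁, m₁), (J₂, m₂)) = s((2, m), (1, -m)) ∨
         s((J₁, m₁), (J₂, m₂)) = s((2, m), (1, 0)) ∨
         s((J₁, m₁), (J₂, m₂)) = s((2, m), (2, -m))) := by
  constructor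
  · rintro ⟨hm, ⟨rfl | rfl, rfl | rfl⟩ | ⟨rfl, rfl⟩, ⟨rfl | rfl, rfl | rfl⟩ | ⟨rfl, rfl⟩⟩ <;>
      simp_all
  · rintro ⟨m, rfl | rfl, h⟩ <;> simp only [Sym2.eq_iff, Prod.mk.injEq] at h <;>
      unfold IsTLLabel <;> omega

lemma isTLLabel_opposite_iff (hJ : J₂ ≤ J₁) :
    (m₁ ≠ m₂ ∧ IsTLLabel J₁ m₁ ∧ IsTLLabel J₂ m₂ ∧ J₁ ≠ J₂ ∧ m₁ + m₂ = 0) ↔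
      (J₁ = 2 ∧ m₁ = 1 ∧ J₂ = 1 ∧ m₂ = -1) ∨ (J₁ = 2 ∧ m₁ = -1 ∧ J₂ = 1 ∧ m₂ = 1) := by
  unfold IsTLLabel
  omega

end Labels

end TLPairs

theorem theorem6 (d J₁ J₂ : ℕ) (m₁ m₂ : ℤ)
    (hJ₁ : J₁ ≤ d) (hJ₂ : J₂ ≤ d) (hm₁ : |m₁| ≤ (J₁ : ℤ)) (hm₂ : |m₂| ≤ (J₂ : ℤ))
    (hJ : J₂ ≤ J₁) :
    -- part a): the TL pairs at `q = 1`, and the value of `Q`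
    ((TLPairs.IsTLPair d 1 J₁ m₁ J₂ m₂ ↔
        d = 2 ∧ ∃ m : ℤ, (m = 1 ∨ m = -1) ∧
          (s((J₁, m₁), (J₂, m₂)) = s((1, m), (1, -m)) ∨
           s((J₁, m₁), (J₂, m₂)) = s((1, m), (1, 0)) ∨
           s((J₁, m₁), (J₂, m₂)) = s((2, m), (1, -m)) ∨
           s((J₁, m₁), (J₂, m₂)) = s((2, m), (1, 0)) ∨
           s((J₁, m₁), (J₂, m₂)) = s((2, m), (2, -m)))) ∧
      (TLPairs.IsTLPair d 1 J₁ m₁ J₂ m₂ →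
        ∀ Q : ℝ, 0 < Q → (TLPairs.IsTLPairWith d 1 Q J₁ m₁ J₂ m₂ ↔ Q = 2))) ∧
    -- part b): the pairs that are TL pairs for all `q > 0`, and the value of `Q`
    (((∀ q : ℝ, 0 < q → TLPairs.IsTLPair d q J₁ m₁ J₂ m₂) ↔
        d = 2 ∧
          ((J₁ = 2 ∧ m₁ = 1 ∧ J₂ = 1 ∧ m₂ = -1) ∨
           (J₁ = 2 ∧ m₁ = -1 ∧ J₂ = 1 ∧ m₂ = 1))) ∧
      ((∀ q : ℝ, 0 < q → TLPairs.IsTLPair d q J₁ m₁ J₂ m₂) →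
        ∀ q : ℝ, 0 < q → ∀ Q : ℝ, 0 < Q →
          (TLPairs.IsTLPairWith d q Q J₁ m₁ J₂ m₂ ↔ Q = q ^ 2 + (q ^ 2)⁻¹))) := by
  refine ⟨⟨?_, fun ⟨_, _, h⟩ Q hQ => ?_⟩, ?_, fun h q hq Q hQ => ?_⟩
  · rw [TLPairs.isTLPair_at_one_iff, TLPairs.isTLLabel_pair_iff]
  · rw [TLPairs.isTLPairWith_at_one_iff hQ]
    exact and_iff_left (h.isTLLabel ‹_›)
  · rw [TLPairs.forall_isTLPair_iff, TLPairs.isTLLabel_opposite_iff hJ]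
  · obtain ⟨rfl, hm, h₁, h₂, hopp⟩ := TLPairs.forall_isTLPair_iff.1 h
    rw [TLPairs.isTLPairWith_two_iff hq hQ h₁ h₂ hm]
    exact and_iff_left (Or.inr hopp)
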